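/- **Setting.** Let $\Gamma=(G,E)$ be a countably infinite, connected, locally finite, unoriented graph without loops or multiple edges, with symmetric nonnegative edge weights $\pi_{xy}=\pi_{yx}$ such that $\pi_{xy}>0$ if and only if $\{x,y\}\in E$; put $\pi_x=\sum_{y\sim x}\pi_{xy}$. Let $(\theta_x)_{x\in G}$ be positive vertex weights, and let $(X_t)_{t\ge0}$ be the continuous-time simple random walk with generator $(\mathcal L_\theta f)(x)=\frac1{\theta_x}\sum_{y\sim x}\pi_{xy}(f(y)-f(x))$: at $x$ it waits an exponential time of rate $\pi_x/\theta_x$ and then jumps to $y$ with probability $\pi_{xy}/\pi_x$; it is killed at its explosion time, which may be finite. Its heat kernel is $p_t(x,y)=\frac1{\theta_y}\mathbb P^x(X_t=y)$. Let $d_\theta$ be a metric on $G$ such that $\frac1{\theta_x}\sum_{y\sim x}\pi_{xy}d_\theta^2(x,y)\le1$ for all $x\in G$, and $d_\theta(x,y)\le1$ whenever $x\sim y$. For $A\ge1$ and $\gamma>1$, a nondecreasing function $f:(0,\infty)\to(0,\infty)$ is called $(A,\gamma)$-regular if $$\frac{f(\gamma t_1)}{f(t_1)}\le A\,\frac{f(\gamma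 t_2)}{f(t_2)}\qquad\text{for all }0<t_1<t_2.$$ **Corollary 1.2.** For every $\gamma>1$ there are constants $C_2=C_2(\gamma)>0$ and $\alpha=\alpha(\gamma)>0$, and for all $A\ge1$ and $C_\theta>0$ a constant $C_1=C_1(A,\gamma,C_\theta)>0$, such that the following holds for all $\Gamma,\pi,\theta,d_\theta$ as above. Suppose that $\theta_x\ge C_\theta$ for every $x\in G$, that $f$ is $(A,\gamma)$-regular with $\sup_{0<t<\infty}f(t)/e^{t^{1/2}}\le A$, and that $$\sup_{x\in G}p_t(x,x)\le\frac1{f(t)}\qquad\text{for all }t>0.$$ Then for all $x_1,x_2\in G$ and all $t\ge1\vee d_\theta(x_1,x_2)$, $$p_t(x_1,x_2)\le\frac{C_1}{f(\alpha t)}\exp\left(-C_2\frac{d_\theta^2(x_1,x_2)}{t}\right).$$ -/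

import Mathlib

open MeasureTheory ProbabilityTheory

universe u

noncomputable section

/-- A weighted graph on the vertex set `V`: an unoriented, connected, locally finite simple graph
together with symmetric nonnegative edge weights `π x y` that are positive exactly on the edges. -/
structure WeightedGraph (V : Type u) where
  graph : SimpleGraph V
  connected : graph.Connected
  locallyFinite : ∀ x, (graph.neighborSet x).Finite
  π : V → V → ℝ
  π_nonneg : ∀ x y, 0 ≤ π x y
  π_symm : ∀ x y, π x y = π y x
  π_pos_iff : ∀ x y, 0 < π x y ↔ graph.Adj x y

/-- A weighted graph together with an arbitrary collection of positive vertex weights `θ`. -/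
structure SpeedGraph (V : Type u) extends WeightedGraph V where
  θ : V → ℝ
  θ_pos : ∀ x, 0 < θ x

namespace WeightedGraph

variable {V : Type u} (Γ : WeightedGraph V)

/-- The finite set of neighbours of `x`. -/
def nbrs (x : V) : Finset V := (Γ.locallyFinite x).toFinset

/-- The vertex measure `π_x = ∑_{y ∼ x} π_{xy}`. -/
def πv (x : V) : ℝ := ∑ y ∈ Γ.nbrs x, Γ.π x y

theorem mem_nbrs {x y : V} : y ∈ Γ.nbrs x ↔ Γ.graph.Adj x y := by
  simp [nbrs]

theorem πv_pos [Nontrivial V] (x : V) : 0 < Γ.πv x := by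
  obtain ⟨y, hy⟩ := Γ.connected.preconnected.exists_adj_of_nontrivial x
  exact Finset.sum_pos' (fun z _ => Γ.π_nonneg x z)
    ⟨y, Γ.mem_nbrs.2 hy, (Γ.π_pos_iff x y).2 hy⟩

variable [MeasurableSpace V]

/-- The law of a jump from `x`: to `y` with probability `P(x,y) = π_{xy} / π_x`. -/
def jumpLaw (x : V) : Measure V :=
  ∑ y ∈ Γ.nbrs x, ENNReal.ofReal (Γ.π x y / Γ.πv x) • Measure.dirac y

instance isProbabilityMeasure_jumpLaw [Nontrivial V] (x : V) :
    IsProbabilityMeasure (Γ.jumpLaw x) := by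
  constructor
  have h := Γ.πv_pos x
  simp only [jumpLaw, Measure.coe_finsetSum, Finset.sum_apply, Measure.smul_apply,
    measure_univ, smul_eq_mul, mul_one]
  rw [← ENNReal.ofReal_sum_of_nonneg (fun y _ => div_nonneg (Γ.π_nonneg x y) h.le),
    ← Finset.sum_div]
  change ENNReal.ofReal (Γ.πv x / Γ.πv x) = 1
  rw [div_self h.ne', ENNReal.ofReal_one]

end WeightedGraph

namespace SpeedGraph

variable {V : Type u} (Γ : SpeedGraph V)

/-- The total jump rate `π_x / θ_x` out of `x` of the walk with generator
`(L_θ f)(x) = θ_x⁻¹ ∑_{y ∼ x} π_{xy} (f y - f x)`. -/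
def rate (x : V) : ℝ := Γ.πv x / Γ.θ x

theorem rate_pos [Nontrivial V] (x : V) : 0 < Γ.rate x :=
  div_pos (Γ.πv_pos x) (Γ.θ_pos x)

variable [MeasurableSpace V] [DiscreteMeasurableSpace V]

/-- One step of the walk from `x`: the next vertex, and, independently of it, the holding time
at `x`, which is exponential with rate `π_x / θ_x`. -/
def stepKernel : Kernel V (V × ℝ) :=
  ⟨fun x => (Γ.jumpLaw x).prod (expMeasure (Γ.rate x)), Measurable.of_discrete⟩

instance isMarkovKernel_stepKernel [Nontrivial V] : IsMarkovKernel Γ.stepKernel := by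
  constructor
  intro x
  have := isProbabilityMeasure_expMeasure (Γ.rate_pos x)
  change IsProbabilityMeasure ((Γ.jumpLaw x).prod (expMeasure (Γ.rate x)))
  infer_instance

/-- The step kernel read from the history `h` of the first `n` steps: it depends on the current
vertex only. -/
def historyKernel (n : ℕ) : Kernel ((i : Finset.Iic n) → V × ℝ) (V × ℝ) :=
  Γ.stepKernel.comap (fun h => (h ⟨n, Finset.mem_Iic.2 le_rfl⟩).1)
    (measurable_fst.comp (measurable_pi_apply _))

instance isMarkovKernel_historyKernel [Nontrivial V] (n : ℕ) :
    IsMarkovKernel (Γ.historyKernel n) := by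
  unfold historyKernel
  infer_instance

/-- The law `ℙ^x` of the continuous time simple random walk started at `x`, on the space of
sequences `ω n = (Y n, S n)`: `Y` is the jump chain, `Y 0 = x`, `S 0 = 0`, and `S (n + 1)` is
the holding time at `Y n`, that is, the time between the `n`-th and the `(n + 1)`-st jump. -/
def pathLaw [Nontrivial V] (x : V) : Measure (ℕ → V × ℝ) :=
  Kernel.traj (X := fun _ => V × ℝ) Γ.historyKernel 0 (fun _ => (x, 0))

end SpeedGraph

/-- The time `S 0 + ⋯ + S n` of the `n`-th jump. -/
def jumpTime {V : Type u} (ω : ℕ → V × ℝ) (n : ℕ) : ℝ := ∑ i ∈ Finset.range (n + 1), (ω i).2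

open Classical in
/-- The position `X_t` of the walk: `Y n` if the time `t` lies between the `n`-th and the
`(n + 1)`-st jump, and the cemetery `none` after the explosion time. -/
def walk {V : Type u} (t : ℝ) (ω : ℕ → V × ℝ) : Option V :=
  if h : ∃ n, jumpTime ω n ≤ t ∧ t < jumpTime ω (n + 1) then some (ω (Nat.find h)).1 else none

/-- The heat kernel `p_t(x,y) = θ_y⁻¹ ℙ^x(X_t = y)`. -/
def SpeedGraph.heatKernel {V : Type u} (Γ : SpeedGraph V) [Nontrivial V] [MeasurableSpace V]
    [DiscreteMeasurableSpace V] (t : ℝ) (x y : V) : ℝ :=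
  (1 / Γ.θ y) * (Γ.pathLaw x).real {ω | walk t ω = some y}

/-- `d` is a metric on the vertex set that is adapted to the vertex weights `θ`. -/
structure SpeedGraph.IsAdaptedMetric {V : Type u} (Γ : SpeedGraph V) (d : V → V → ℝ) : Prop where
  eq_zero_iff : ∀ x y, d x y = 0 ↔ x = y
  symm : ∀ x y, d x y = d y x
  triangle : ∀ x y z, d x z ≤ d x y + d y z
  energy_le_one : ∀ x, (1 / Γ.θ x) * ∑ y ∈ Γ.nbrs x, Γ.π x y * d x y ^ 2 ≤ 1
  le_one_of_adj : ∀ x y, Γ.graph.Adj x y → d x y ≤ 1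

/-- `g : (0,∞) → (0,∞)` is `(A,γ)`-regular: it is nondecreasing and
`g(γ t₁) / g(t₁) ≤ A g(γ t₂) / g(t₂)` for all `0 < t₁ < t₂`.
Only the values of `g` on `(0,∞)` matter. -/
structure IsAGammaRegular (A γ : ℝ) (g : ℝ → ℝ) : Prop where
  one_le : 1 ≤ A
  one_lt : 1 < γ
  pos : ∀ t, 0 < t → 0 < g t
  mono : MonotoneOn g (Set.Ioi 0)
  ratio_le : ∀ t₁ t₂, 0 < t₁ → t₁ < t₂ → g (γ * t₁) / g t₁ ≤ A * (g (γ * t₂) / g t₂)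

end

/-! ### Jump times and exponential holding times. -/

noncomputable section

open scoped ENNReal
open Set

/-! The analysis is done on finite sets. For finite `A` the walk killed on leaving `A` has
transition matrix `exp (t • killedGen A)`, which is nonnegative, reversible with respect to `θ` and
smooth in time. It is dominated by the path law (`killedSemigroup_le_pathLaw`), so it inherits the
on-diagonal bound. Conversely, any bound valid for all finite `A` passes to the full walk
(`pathLaw_le_of_killedSemigroup_le`). Explosion does no harm, since only paths with finitely many
jumps are counted.

For the killed kernel `p`, let `E_l(t) = ∑_y p_t(x,y)² e^{l d(x,y)} θ_y`. Three facts carry the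
estimate. Adaptedness of the metric gives `E_l' ≤ (l²/2) E_l` for `0 ≤ l ≤ 1`. Cauchy–Schwarz gives
`E_l² ≤ E_0 E_{2l}`. Reversibility gives `E_0(t) = p_{2t}(x,x) ≤ 1 / f(2t)`. Going back from `t` to
`t / g` and doubling `l` at each stage, the process stops once `l > 1/2`; there the trivial bound
`E_l(t) ≤ e^{l² t / 2} / θ_x` suffices, because `f` grows at most like `e^{√t}` and `θ` is bounded
below. Regularity of `f` keeps one constant through all stages, giving `E_l(t) ≤ M e^{l² t} / f(t /
g²)` (`weightedEnergy_le`).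

Finally, splitting `p_t(x₁,x₂)` at time `t / 2` and using the triangle inequality gives the factor
`e^{-l d / 2}` (`killedHeat_le`); then `l` is optimised. -/

theorem measurable_jumpTime {V : Type u} [MeasurableSpace V] (n : ℕ) :
    Measurable fun ω : ℕ → V × ℝ => jumpTime ω n := by
  unfold jumpTime
  fun_prop

theorem jumpTime_succ {V : Type u} (ω : ℕ → V × ℝ) (n : ℕ) :
    jumpTime ω (n + 1) = jumpTime ω n + (ω (n + 1)).2 := by
  simp [jumpTime, Finset.sum_range_succ _ (n + 1)]

theorem expMeasure_Ioi {r : ℝ} (hr : 0 < r) {a : ℝ} (ha : 0 ≤ a) :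
    expMeasure r (Ioi a) = ENNReal.ofReal (Real.exp (-(r * a))) := by
  have := isProbabilityMeasure_expMeasure hr
  have h1 : expMeasure r (Iic a) = ENNReal.ofReal (1 - Real.exp (-(r * a))) := by
    rw [← ofReal_cdf, cdf_expMeasure_eq hr, if_pos ha]
  have h2 : Ioi a = (Iic a)ᶜ := by simp
  rw [h2, prob_compl_eq_one_sub measurableSet_Iic, h1, ← ENNReal.ofReal_one,
    ← ENNReal.ofReal_sub _ (by simp; positivity)]
  simp

theorem lintegral_expMeasure {r : ℝ} {g : ℝ → ℝ≥0∞} (hg : Measurable g) :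
    ∫⁻ s, g s ∂(expMeasure r) =
      ∫⁻ s in Ici 0, ENNReal.ofReal (r * Real.exp (-(r * s))) * g s := by
  have hm : Measurable (exponentialPDF r) := (measurable_exponentialPDFReal r).ennreal_ofReal
  change ∫⁻ s, g s ∂(volume.withDensity (exponentialPDF r)) = _
  rw [lintegral_withDensity_eq_lintegral_mul _ hm hg, ← lintegral_indicator measurableSet_Ici]
  refine lintegral_congr fun s => ?_
  by_cases hs : 0 ≤ s
  · simp [indicator, hs, exponentialPDF_of_nonneg]
  · simp [indicator, hs, exponentialPDF_of_neg (not_le.1 hs)]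

theorem expMeasure_Iio_zero {r : ℝ} : expMeasure r (Iio 0) = 0 := by
  rw [← lintegral_indicator_one measurableSet_Iio,
    lintegral_expMeasure (measurable_one.indicator measurableSet_Iio),
    setLIntegral_congr_fun (g := fun _ => 0) measurableSet_Ici]
  · simp
  · intro s hs
    have : ¬ s < 0 := not_lt.2 hs
    simp [indicator, this]

theorem WeightedGraph.π_eq_zero {V : Type u} (Γ : WeightedGraph V) {x y : V}
    (h : ¬ Γ.graph.Adj x y) : Γ.π x y = 0 :=
  le_antisymm (not_lt.1 fun h' => h ((Γ.π_pos_iff x y).1 h')) (Γ.π_nonneg x y)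

/-! ### The path law: Markov property at a jump and decomposition by the number of jumps. -/

namespace SpeedGraph

variable {V : Type u} (Γ : SpeedGraph V)

/-- The jump rate `π_{xy} / θ_x` from `x` to `y`. -/
def jumpRate (x y : V) : ℝ := Γ.π x y / Γ.θ x

theorem jumpRate_nonneg (x y : V) : 0 ≤ Γ.jumpRate x y :=
  div_nonneg (Γ.π_nonneg x y) (Γ.θ_pos x).le

theorem jumpTime_nonneg {ω : ℕ → V × ℝ} (h : ∀ n, 0 ≤ (ω n).2) (n : ℕ) : 0 ≤ jumpTime ω n :=
  Finset.sum_nonneg fun i _ => h i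

theorem jumpTime_monotone {ω : ℕ → V × ℝ} (h : ∀ n, 0 ≤ (ω n).2) : Monotone (jumpTime ω) :=
  monotone_nat_of_le_succ fun n => by rw [jumpTime_succ]; linarith [h (n + 1)]

variable [MeasurableSpace V] [DiscreteMeasurableSpace V]

theorem jumpLaw_singleton (x y : V) :
    Γ.jumpLaw x {y} = ENNReal.ofReal (Γ.π x y / Γ.πv x) := by
  classical
  simp only [WeightedGraph.jumpLaw, Measure.coe_finsetSum, Finset.sum_apply, Measure.smul_apply,
    smul_eq_mul, MeasurableSet.of_discrete, Measure.dirac_apply', indicator,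
    mem_singleton_iff, Pi.one_apply, mul_ite, mul_one, mul_zero, Finset.sum_ite_eq']
  split_ifs with h
  · rfl
  · rw [Γ.mem_nbrs] at h
    simp [Γ.π_eq_zero h]

theorem measurableSet_jumpProb (n : ℕ) (t : ℝ) (y : V) : MeasurableSet
    {ω : ℕ → V × ℝ | jumpTime ω n ≤ t ∧ t < jumpTime ω (n + 1) ∧ (ω n).1 = y} :=
  (measurableSet_le (measurable_jumpTime n) measurable_const).inter
    ((measurableSet_lt measurable_const (measurable_jumpTime (n + 1))).inter
      ((measurable_fst.comp (measurable_pi_apply n)) (MeasurableSet.of_discrete (s := {y}))))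

variable [Nontrivial V]

instance isProbabilityMeasure_pathLaw (x : V) : IsProbabilityMeasure (Γ.pathLaw x) := by
  unfold pathLaw
  infer_instance

/-- The Markov property at the `n`-th jump: vertex and jump time are functions of the first `n`
steps, and the next step has law `stepKernel` given that history. All later path computations go
through this identity. -/
theorem lintegral_step [Countable V] (x : V) (n : ℕ) {G : V × ℝ → V × ℝ → ℝ≥0∞}
    (hG : Measurable (Function.uncurry G)) :
    ∫⁻ ω, G ((ω n).1, jumpTime ω n) (ω (n + 1)) ∂(Γ.pathLaw x) =
      ∫⁻ ω, ∫⁻ w, G ((ω n).1, jumpTime ω n) w ∂(Γ.stepKernel (ω n).1) ∂(Γ.pathLaw x) := by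
  let last : ((i : Finset.Iic n) → V × ℝ) → V × ℝ := fun h =>
    ((h ⟨n, Finset.mem_Iic.2 le_rfl⟩).1, ∑ i : Finset.Iic n, (h i).2)
  have hlast : Measurable last := by fun_prop
  have hl : ∀ ω : ℕ → V × ℝ, last (Preorder.frestrictLe n ω) = ((ω n).1, jumpTime ω n) := by
    intro ω
    simp only [last, jumpTime, Preorder.frestrictLe_apply, Prod.mk.injEq, true_and]
    rw [Finset.sum_coe_sort (Finset.Iic n) (fun i => (ω i).2)]
    congr 1
    ext i
    simp
  have key := Kernel.partialTraj_compProd_eq_map_traj (X := fun _ => V × ℝ)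
    (κ := Γ.historyKernel) (Nat.zero_le n) (x₀ := fun _ => (x, 0))
  have hmK : Measurable fun p : V × ℝ => ∫⁻ w, G p w ∂(Γ.stepKernel p.1) := by
    have := Measurable.lintegral_kernel_prod_right
      (κ := Γ.stepKernel.comap (fun p : V × ℝ => p.1) measurable_fst) (f := G) hG
    simpa using this
  have hH : Measurable fun q : ((i : Finset.Iic n) → V × ℝ) × (V × ℝ) => G (last q.1) q.2 :=
    hG.comp ((hlast.comp measurable_fst).prodMk measurable_snd)
  have h1 := Measure.lintegral_compProd (μ := Kernel.partialTraj (X := fun _ => V × ℝ)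
    Γ.historyKernel 0 n (fun _ => (x, 0))) (κ := Γ.historyKernel n) hH
  rw [key, lintegral_map hH (by fun_prop),
    ← Kernel.traj_map_frestrictLe_apply (X := fun _ => V × ℝ),
    lintegral_map (by exact hmK.comp hlast) (by fun_prop)] at h1
  refine Eq.trans ?_ (h1.trans ?_)
  · simp only [hl]
    rfl
  · refine lintegral_congr fun ω => ?_
    change ∫⁻ w, G (last (Preorder.frestrictLe n ω)) w ∂(Γ.stepKernel (ω n).1) = _
    rw [hl]

theorem stepKernel_apply_prod (x : V) (s : Set V) (t : Set ℝ) :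
    Γ.stepKernel x (s ×ˢ t) = Γ.jumpLaw x s * expMeasure (Γ.rate x) t := by
  have := isProbabilityMeasure_expMeasure (Γ.rate_pos x)
  exact Measure.prod_prod s t

theorem pathLaw_zero (x : V) : ∀ᵐ ω ∂(Γ.pathLaw x), ω 0 = (x, 0) := by
  have h := Kernel.traj_map_frestrictLe_apply (X := fun _ => V × ℝ)
    (κ := Γ.historyKernel) 0 0 (fun _ => (x, 0))
  rw [Kernel.partialTraj_self] at h
  have h2 : ∀ᵐ p ∂((Γ.pathLaw x).map (Preorder.frestrictLe (π := fun _ => V × ℝ) 0)),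
      p ⟨0, Finset.mem_Iic.2 le_rfl⟩ = (x, (0 : ℝ)) := by
    unfold pathLaw
    rw [h, Kernel.id_apply, ae_dirac_iff]
    have : {p : (i : Finset.Iic 0) → V × ℝ | p ⟨0, Finset.mem_Iic.2 le_rfl⟩ = (x, (0 : ℝ))} =
        (fun p => p ⟨0, Finset.mem_Iic.2 le_rfl⟩) ⁻¹' ({x} ×ˢ {0}) := by
      ext p
      simp [Prod.ext_iff]
    rw [this]
    exact measurable_pi_apply _ (MeasurableSet.of_discrete.prod (measurableSet_singleton 0))
  exact ae_of_ae_map (by fun_prop) h2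

theorem ae_holding_nonneg [Countable V] (x : V) :
    ∀ᵐ ω ∂(Γ.pathLaw x), ∀ n, 0 ≤ (ω n).2 := by
  rw [ae_all_iff]
  rintro (_ | n)
  · filter_upwards [Γ.pathLaw_zero x] with ω hω
    simp [hω]
  · have hs : MeasurableSet {w : V × ℝ | w.2 < 0} := measurableSet_lt (by fun_prop) (by fun_prop)
    have h := Γ.lintegral_step x n (G := fun _ w => {w : V × ℝ | w.2 < 0}.indicator 1 w)
      ((measurable_one.indicator hs).comp measurable_snd)
    have h0 : ∀ z, Γ.stepKernel z {w : V × ℝ | w.2 < 0} = 0 := by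
      intro z
      have : {w : V × ℝ | w.2 < 0} = univ ×ˢ Iio 0 := by ext; simp
      rw [this, stepKernel_apply_prod, expMeasure_Iio_zero, mul_zero]
    simp only [lintegral_indicator_one hs, h0, lintegral_zero] at h
    have hs' : MeasurableSet {ω : ℕ → V × ℝ | (ω (n + 1)).2 < 0} :=
      measurableSet_lt (by fun_prop) (by fun_prop)
    have h' : Γ.pathLaw x {ω : ℕ → V × ℝ | (ω (n + 1)).2 < 0} = 0 := by
      rw [← lintegral_indicator_one hs', ← h]
      rfl
    rw [ae_iff]
    simpa using h'

/-- The probability that the walk from `x` makes exactly `n` jumps until time `t` and is then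
at `y`. -/
def jumpProb (x : V) (n : ℕ) (t : ℝ) (y : V) : ℝ≥0∞ :=
  Γ.pathLaw x {ω | jumpTime ω n ≤ t ∧ t < jumpTime ω (n + 1) ∧ (ω n).1 = y}

theorem jumpProb_of_neg [Countable V] (x : V) (n : ℕ) {t : ℝ} (ht : t < 0) (y : V) :
    Γ.jumpProb x n t y = 0 := by
  have : ∀ᵐ ω ∂(Γ.pathLaw x),
      ¬ (jumpTime ω n ≤ t ∧ t < jumpTime ω (n + 1) ∧ (ω n).1 = y) := by
    filter_upwards [Γ.ae_holding_nonneg x] with ω hω h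
    linarith [jumpTime_nonneg hω n, h.1]
  rw [ae_iff] at this
  simpa [jumpProb] using this

/-- Holding times are almost surely nonnegative, so jump times are monotone and at most one `n` has
`t` between jumps `n` and `n + 1`. The events are therefore almost surely disjoint, and the index
chosen by `Nat.find` is the only one. -/
theorem pathLaw_walk_eq [Countable V] (x y : V) (t : ℝ) :
    Γ.pathLaw x {ω | walk t ω = some y} = ∑' n, Γ.jumpProb x n t y := by
  have huniq : ∀ ω : ℕ → V × ℝ, (∀ n, 0 ≤ (ω n).2) → ∀ m n,
      jumpTime ω m ≤ t → t < jumpTime ω (m + 1) → jumpTime ω n ≤ t → t < jumpTime ω (n + 1) →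
      m = n := by
    intro ω hω m n h1 h2 h3 h4
    by_contra hne
    rcases lt_or_gt_of_ne hne with h | h
    · linarith [jumpTime_monotone hω (Nat.succ_le_of_lt h)]
    · linarith [jumpTime_monotone hω (Nat.succ_le_of_lt h)]
  have hset : {ω | walk t ω = some y} =ᵐ[Γ.pathLaw x]
      ⋃ n, {ω | jumpTime ω n ≤ t ∧ t < jumpTime ω (n + 1) ∧ (ω n).1 = y} := by
    filter_upwards [Γ.ae_holding_nonneg x] with ω hω
    apply propext
    change walk t ω = some y ↔ ω ∈ ⋃ n, _
    simp only [mem_iUnion, mem_ofPred_eq, walk]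
    constructor
    · intro h
      split_ifs at h with hex
      exact ⟨_, (Nat.find_spec hex).1, (Nat.find_spec hex).2, by simpa using h⟩
    · rintro ⟨n, h1, h2, h3⟩
      have hex : ∃ n, jumpTime ω n ≤ t ∧ t < jumpTime ω (n + 1) := ⟨n, h1, h2⟩
      rw [dif_pos hex, huniq ω hω _ n (Nat.find_spec hex).1 (Nat.find_spec hex).2 h1 h2, h3]
  rw [measure_congr hset, measure_iUnion₀]
  · rfl
  · intro m n hmn
    change _ = _
    refine measure_mono_null (t := {ω | ¬ ∀ n, 0 ≤ (ω n).2}) ?_ (Γ.ae_holding_nonneg x)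
    rintro ω ⟨h1, h2⟩ hω
    exact hmn (huniq ω hω m n h1.1 h1.2.1 h2.1 h2.2.1)
  · exact fun n => (measurableSet_jumpProb n t y).nullMeasurableSet

/-- Integrates out the holding time after the `n`-th jump, which leaves the exponential survival
factor at `y`. -/
theorem jumpProb_eq_lintegral [Countable V] (x : V) (n : ℕ) (t : ℝ) (y : V) :
    Γ.jumpProb x n t y = ∫⁻ ω, {p : V × ℝ | p.2 ≤ t ∧ p.1 = y}.indicator
      (fun p => ENNReal.ofReal (Real.exp (-(Γ.rate y * (t - p.2))))) ((ω n).1, jumpTime ω n)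
      ∂(Γ.pathLaw x) := by
  have hS : MeasurableSet {q : (V × ℝ) × (V × ℝ) |
      q.1.2 ≤ t ∧ t < q.1.2 + q.2.2 ∧ q.1.1 = y} :=
    (measurableSet_le (f := fun q : (V × ℝ) × (V × ℝ) => q.1.2) (by fun_prop)
      measurable_const).inter
      ((measurableSet_lt (g := fun q : (V × ℝ) × (V × ℝ) => q.1.2 + q.2.2) measurable_const
        (by fun_prop)).inter
        ((measurable_fst.comp measurable_fst) (MeasurableSet.of_discrete (s := {y}))))
  have h := Γ.lintegral_step x n (G := fun p w => {q : (V × ℝ) × (V × ℝ) |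
      q.1.2 ≤ t ∧ t < q.1.2 + q.2.2 ∧ q.1.1 = y}.indicator 1 (p, w))
    (measurable_one.indicator hS)
  rw [jumpProb, ← lintegral_indicator_one (measurableSet_jumpProb n t y)]
  refine Eq.trans ?_ (h.trans ?_)
  · refine lintegral_congr fun ω => ?_
    simp only [indicator, mem_ofPred_eq, Pi.one_apply]
    congr 1
    rw [jumpTime_succ]
  · refine lintegral_congr fun ω => ?_
    by_cases hω : jumpTime ω n ≤ t ∧ (ω n).1 = y
    · obtain ⟨h1, h2⟩ := hω
      have hs : MeasurableSet ((univ : Set V) ×ˢ Ioi (t - jumpTime ω n)) :=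
        MeasurableSet.univ.prod measurableSet_Ioi
      rw [indicator_of_mem (by exact ⟨h1, h2⟩),
        ← expMeasure_Ioi (Γ.rate_pos y) (by linarith : 0 ≤ t - jumpTime ω n)]
      have h3 := Γ.stepKernel_apply_prod y univ (Ioi (t - jumpTime ω n))
      rw [measure_univ, one_mul] at h3
      rw [← h3, ← h2, ← lintegral_indicator_one hs]
      refine lintegral_congr fun w => ?_
      simp [indicator, h1, h2, sub_lt_iff_lt_add']
    · rw [indicator_of_notMem (by exact hω)]
      refine Eq.trans (lintegral_congr fun w => ?_) lintegral_zero
      rw [indicator_of_notMem]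
      exact fun h' => hω ⟨h'.1, h'.2.2⟩

open Classical in
theorem jumpProb_zero [Countable V] (x : V) {t : ℝ} (ht : 0 ≤ t) (y : V) :
    Γ.jumpProb x 0 t y =
      ENNReal.ofReal (if y = x then Real.exp (-(Γ.rate y * t)) else 0) := by
  rw [jumpProb_eq_lintegral]
  have : ∀ᵐ ω ∂(Γ.pathLaw x), {p : V × ℝ | p.2 ≤ t ∧ p.1 = y}.indicator
      (fun p => ENNReal.ofReal (Real.exp (-(Γ.rate y * (t - p.2))))) ((ω 0).1, jumpTime ω 0) =
      ENNReal.ofReal (if y = x then Real.exp (-(Γ.rate y * t)) else 0) := by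
    filter_upwards [Γ.pathLaw_zero x] with ω hω
    by_cases h : y = x
    · simp [indicator, jumpTime, hω, ht, h]
    · simp [indicator, jumpTime, hω, ht, h, Ne.symm h]
  rw [lintegral_congr_ae this]
  simp

end SpeedGraph

/-! ### The forward recursion in the last jump, and its truncation to finite sets. -/

namespace SpeedGraph

variable {V : Type u} (Γ : SpeedGraph V) [MeasurableSpace V] [DiscreteMeasurableSpace V]
  [Nontrivial V]

/-- Substitutes `s = T + holding time`, the instant of the jump. The holding density times the jump
probability is the survival factor at `z` times `jumpRate z y`, as `rate z * (π_{zy} / π_z) = π_{zy}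
/ θ_z`. -/
theorem lintegral_stepKernel_jump (z y : V) (T t : ℝ) :
    ∫⁻ w, {p : V × ℝ | p.2 ≤ t ∧ p.1 = y}.indicator
      (fun p => ENNReal.ofReal (Real.exp (-(Γ.rate y * (t - p.2))))) (w.1, T + w.2)
      ∂(Γ.stepKernel z) =
    ∫⁻ s in Iic t, (Ici T).indicator
      (fun s => ENNReal.ofReal (Real.exp (-(Γ.rate z * (s - T))))) s *
        ENNReal.ofReal (Γ.jumpRate z y * Real.exp (-(Γ.rate y * (t - s)))) := by
  have := isProbabilityMeasure_expMeasure (Γ.rate_pos z)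
  set g : ℝ → ℝ≥0∞ := (Iic t).indicator
    (fun s => ENNReal.ofReal (Real.exp (-(Γ.rate y * (t - s))))) with hg
  have hgm : Measurable g := Measurable.indicator (by fun_prop) measurableSet_Iic
  have h1 : ∀ w : V × ℝ, {p : V × ℝ | p.2 ≤ t ∧ p.1 = y}.indicator
      (fun p => ENNReal.ofReal (Real.exp (-(Γ.rate y * (t - p.2))))) (w.1, T + w.2) =
      ({y} : Set V).indicator 1 w.1 * g (T + w.2) := by
    intro w
    by_cases hw : w.1 = y <;> by_cases hs : T + w.2 ≤ t <;> simp [indicator, hg, hw, hs]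
  have hπ : 0 < Γ.πv z := Γ.πv_pos z
  simp_rw [h1]
  change ∫⁻ w, _ ∂((Γ.jumpLaw z).prod (expMeasure (Γ.rate z))) = _
  rw [lintegral_prod_mul (f := ({y} : Set V).indicator 1) (g := fun s => g (T + s))
      Measurable.of_discrete.aemeasurable (hgm.comp (by fun_prop)).aemeasurable,
    lintegral_indicator_one MeasurableSet.of_discrete, jumpLaw_singleton,
    lintegral_expMeasure (g := fun s => g (T + s)) (hgm.comp (by fun_prop)),
    ← lintegral_indicator measurableSet_Ici, ← lintegral_indicator measurableSet_Iic,
    ← lintegral_sub_right_eq_self _ T, ← lintegral_const_mul' _ _ ENNReal.ofReal_ne_top]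
  refine lintegral_congr fun s => ?_
  by_cases hs : T ≤ s <;> by_cases hst : s ≤ t
  · simp only [indicator, mem_Ici, mem_Iic, sub_nonneg, hs, hst, if_true, hg,
      add_sub_cancel]
    rw [← ENNReal.ofReal_mul (by have := Γ.rate_pos z; positivity),
      ← ENNReal.ofReal_mul (div_nonneg (Γ.π_nonneg z y) hπ.le),
      ← ENNReal.ofReal_mul (by positivity)]
    congr 1
    simp only [rate, jumpRate]
    field_simp
  · simp [indicator, hs, hst, hg]
  · simp [indicator, hs, hst]
  · simp [indicator, hs, hst]

/-- Decomposition by the time `s` and origin `z` of the last jump: be at `z` at time `s` after `n`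
jumps, jump to `y`, stay there until `t`. -/
theorem jumpProb_succ [Countable V] (x : V) (n : ℕ) (t : ℝ) (y : V) :
    Γ.jumpProb x (n + 1) t y = ∫⁻ s in Icc 0 t, ∑ z ∈ Γ.nbrs y, Γ.jumpProb x n s z *
      ENNReal.ofReal (Γ.jumpRate z y * Real.exp (-(Γ.rate y * (t - s)))) := by
  classical
  have hS : MeasurableSet {p : V × ℝ | p.2 ≤ t ∧ p.1 = y} :=
    (measurableSet_le measurable_snd measurable_const).inter
      (measurable_fst (MeasurableSet.of_discrete (s := {y})))
  have hF : Measurable ({p : V × ℝ | p.2 ≤ t ∧ p.1 = y}.indicator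
      (fun p => ENNReal.ofReal (Real.exp (-(Γ.rate y * (t - p.2)))))) :=
    Measurable.indicator (by fun_prop) hS
  have h := Γ.lintegral_step x n (G := fun p w => {p : V × ℝ | p.2 ≤ t ∧ p.1 = y}.indicator
      (fun p => ENNReal.ofReal (Real.exp (-(Γ.rate y * (t - p.2))))) (w.1, p.2 + w.2))
    (hF.comp (by fun_prop : Measurable fun q : (V × ℝ) × (V × ℝ) => (q.2.1, q.1.2 + q.2.2)))
  rw [jumpProb_eq_lintegral]
  simp_rw [jumpTime_succ]
  rw [h]
  simp_rw [lintegral_stepKernel_jump]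
  let K : (V × ℝ) → ℝ → ℝ≥0∞ := fun p s => (Ici p.2).indicator
    (fun s => ENNReal.ofReal (Real.exp (-(Γ.rate p.1 * (s - p.2))))) s *
      ENNReal.ofReal (Γ.jumpRate p.1 y * Real.exp (-(Γ.rate y * (t - s))))
  have hK : Measurable (Function.uncurry K) := by
    have hr : Measurable fun q : (V × ℝ) × ℝ => Γ.rate q.1.1 :=
      (Measurable.of_discrete (f := Γ.rate)).comp (measurable_fst.comp measurable_fst)
    have hj : Measurable fun q : (V × ℝ) × ℝ => Γ.jumpRate q.1.1 y :=
      (Measurable.of_discrete (f := fun z => Γ.jumpRate z y)).comp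
        (measurable_fst.comp measurable_fst)
    have hS' : MeasurableSet {q : (V × ℝ) × ℝ | q.1.2 ≤ q.2} :=
      measurableSet_le (by fun_prop) (by fun_prop)
    have : Function.uncurry K = fun q : (V × ℝ) × ℝ =>
        {q : (V × ℝ) × ℝ | q.1.2 ≤ q.2}.indicator
          (fun q => ENNReal.ofReal (Real.exp (-(Γ.rate q.1.1 * (q.2 - q.1.2))))) q *
        ENNReal.ofReal (Γ.jumpRate q.1.1 y * Real.exp (-(Γ.rate y * (t - q.2)))) := by
      ext q
      rfl
    rw [this]
    exact (Measurable.indicator (by fun_prop) hS').mul (by fun_prop)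
  change ∫⁻ ω, (∫⁻ s in Iic t, K ((ω n).1, jumpTime ω n) s) ∂(Γ.pathLaw x) = _
  have hω : Measurable fun ω : ℕ → V × ℝ => ((ω n).1, jumpTime ω n) :=
    (by fun_prop : Measurable fun ω : ℕ → V × ℝ => (ω n).1).prodMk (measurable_jumpTime n)
  rw [lintegral_lintegral_swap (f := fun ω s => K ((ω n).1, jumpTime ω n) s)
    (by exact (hK.comp ((hω.comp measurable_fst).prodMk measurable_snd)).aemeasurable)]
  have hcongr : ∀ s, ∫⁻ ω, K ((ω n).1, jumpTime ω n) s ∂(Γ.pathLaw x) =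
      ∑ z ∈ Γ.nbrs y, Γ.jumpProb x n s z *
        ENNReal.ofReal (Γ.jumpRate z y * Real.exp (-(Γ.rate y * (t - s)))) := by
    intro s
    simp_rw [jumpProb_eq_lintegral, ← lintegral_mul_const' _ _ ENNReal.ofReal_ne_top]
    rw [← lintegral_finsetSum']
    · refine lintegral_congr fun ω => ?_
      have hterm : ∀ z, {p : V × ℝ | p.2 ≤ s ∧ p.1 = z}.indicator
          (fun p => ENNReal.ofReal (Real.exp (-(Γ.rate z * (s - p.2)))))
            ((ω n).1, jumpTime ω n) *
          ENNReal.ofReal (Γ.jumpRate z y * Real.exp (-(Γ.rate y * (t - s)))) =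
          if (ω n).1 = z then K ((ω n).1, jumpTime ω n) s else 0 := by
        intro z
        by_cases hz : (ω n).1 = z
        · by_cases hs : jumpTime ω n ≤ s <;> simp [K, indicator, hz, hs]
        · simp [indicator, hz]
      simp_rw [hterm]
      rw [Finset.sum_ite_eq]
      split_ifs with hy
      · rfl
      · rw [Γ.mem_nbrs] at hy
        simp [K, jumpRate, Γ.π_eq_zero fun h' => hy h'.symm]
    · intro z _
      refine Measurable.aemeasurable (Measurable.mul_const (Measurable.comp (Measurable.indicator
        (by fun_prop) ?_) hω) _)
      exact (measurableSet_le measurable_snd measurable_const).inter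
        (measurable_fst (MeasurableSet.of_discrete (s := {z})))
  simp_rw [hcongr]
  rw [← lintegral_indicator measurableSet_Iic, ← lintegral_indicator measurableSet_Icc]
  refine lintegral_congr fun s => ?_
  by_cases hs : 0 ≤ s
  · simp [indicator, hs]
  · simp [indicator, hs, Γ.jumpProb_of_neg x n (not_le.1 hs)]

theorem measurable_jumpProb [Countable V] (x : V) (n : ℕ) (y : V) :
    Measurable fun t => Γ.jumpProb x n t y := by
  simp_rw [jumpProb_eq_lintegral]
  have hω : Measurable fun ω : ℕ → V × ℝ => ((ω n).1, jumpTime ω n) :=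
    (by fun_prop : Measurable fun ω : ℕ → V × ℝ => (ω n).1).prodMk (measurable_jumpTime n)
  have hS : MeasurableSet {q : ℝ × (V × ℝ) | q.2.2 ≤ q.1 ∧ q.2.1 = y} :=
    (measurableSet_le (f := fun q : ℝ × (V × ℝ) => q.2.2) (g := Prod.fst)
      (by fun_prop) (by fun_prop)).inter
      ((measurable_fst.comp measurable_snd) (MeasurableSet.of_discrete (s := {y})))
  have hF : Measurable ({q : ℝ × (V × ℝ) | q.2.2 ≤ q.1 ∧ q.2.1 = y}.indicator
      (fun q => ENNReal.ofReal (Real.exp (-(Γ.rate y * (q.1 - q.2.2)))))) :=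
    Measurable.indicator (by fun_prop) hS
  exact Measurable.lintegral_prod_right'
    (hF.comp (measurable_fst.prodMk (hω.comp measurable_snd)))

theorem sum_jumpProb_succ [Countable V] (x : V) (n : ℕ) (t : ℝ) (y : V) :
    ∑ k ∈ Finset.range (n + 1), Γ.jumpProb x k t y = Γ.jumpProb x 0 t y +
      ∫⁻ s in Icc 0 t, ∑ z ∈ Γ.nbrs y, (∑ k ∈ Finset.range n, Γ.jumpProb x k s z) *
        ENNReal.ofReal (Γ.jumpRate z y * Real.exp (-(Γ.rate y * (t - s)))) := by
  rw [Finset.sum_range_succ', add_comm]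
  congr 1
  simp_rw [jumpProb_succ, Finset.sum_mul]
  rw [← lintegral_finsetSum]
  · exact lintegral_congr fun s => Finset.sum_comm
  · intro k _
    refine Finset.measurable_fun_sum _ fun z _ => (Γ.measurable_jumpProb x k z).mul ?_
    fun_prop

/-- The probability that the walk from `x` killed when it leaves `A` makes less than `n` jumps
until time `t` and is then at `y`, defined by the forward recursion. -/
def killedProb [DecidableEq V] (A : Finset V) (x : V) : ℕ → ℝ → V → ℝ≥0∞
  | 0, _, _ => 0
  | n + 1, t, y => if y ∈ A then Γ.jumpProb x 0 t y + ∫⁻ s in Icc 0 t, ∑ z ∈ Γ.nbrs y,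
      killedProb A x n s z * ENNReal.ofReal (Γ.jumpRate z y * Real.exp (-(Γ.rate y * (t - s))))
    else 0

theorem killedProb_of_notMem [DecidableEq V] {A : Finset V} (x : V) (n : ℕ) (t : ℝ) {y : V}
    (hy : y ∉ A) : Γ.killedProb A x n t y = 0 := by
  cases n <;> simp [killedProb, hy]

theorem killedProb_le [Countable V] [DecidableEq V] (A : Finset V) (x : V) (n : ℕ) (t : ℝ)
    (y : V) : Γ.killedProb A x n t y ≤ ∑ k ∈ Finset.range n, Γ.jumpProb x k t y := by
  induction n generalizing t y with
  | zero => exact zero_le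
  | succ n ih =>
    rw [killedProb, sum_jumpProb_succ]
    split_ifs
    · gcongr with s z
      exact ih s z
    · exact zero_le

/-- By local finiteness only finitely many vertices lead to `y` in fewer than `n` jumps; once `A`
contains them, killing has no effect. -/
theorem exists_killedProb_eq [Countable V] [DecidableEq V] (x : V) (n : ℕ) (y : V) :
    ∃ A₀ : Finset V, ∀ A, A₀ ⊆ A → ∀ t,
      Γ.killedProb A x n t y = ∑ k ∈ Finset.range n, Γ.jumpProb x k t y := by
  induction n generalizing y with
  | zero => exact ⟨∅, fun A _ t => by simp [killedProb]⟩
  | succ n ih =>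
    choose B hB using ih
    refine ⟨insert y ((Γ.nbrs y).biUnion B), fun A hA t => ?_⟩
    rw [killedProb, if_pos (hA (Finset.mem_insert_self _ _)), sum_jumpProb_succ]
    congr 1
    refine lintegral_congr fun s => Finset.sum_congr rfl fun z hz => ?_
    rw [hB z A fun w hw => hA (Finset.mem_insert_of_mem (Finset.mem_biUnion.2 ⟨z, hz, hw⟩))]

end SpeedGraph

/-! ### Entries of matrix exponentials. -/

section MatrixExp

variable {ι : Type*} [Fintype ι] [DecidableEq ι]

open scoped Matrix.Norms.Operator in
theorem Matrix.hasDerivAt_exp_smul_apply (B : Matrix ι ι ℝ) (i j : ι) (t : ℝ) :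
    HasDerivAt (fun t : ℝ => NormedSpace.exp (t • B) i j)
      (∑ k, NormedSpace.exp (t • B) i k * B k j) t := by
  have h := hasDerivAt_exp_smul_const (𝕂 := ℝ) B t
  exact (Matrix.entryLinearMap ℝ ℝ i j).toContinuousLinearMap.hasFDerivAt.comp_hasDerivAt t h

open scoped Matrix.Norms.Operator in
theorem Matrix.exp_apply_nonneg {B : Matrix ι ι ℝ} (hB : ∀ i j, 0 ≤ B i j) (i j : ι) :
    0 ≤ NormedSpace.exp B i j := by
  have hpow : ∀ n : ℕ, ∀ i j, 0 ≤ (B ^ n) i j := by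
    intro n
    induction n with
    | zero => intro i j; rw [pow_zero, Matrix.one_apply]; split_ifs <;> norm_num
    | succ n ih =>
      intro i j
      rw [pow_succ, Matrix.mul_apply]
      exact Finset.sum_nonneg fun k _ => mul_nonneg (ih i k) (hB k j)
  have h := (Matrix.entryLinearMap ℝ ℝ i j).toContinuousLinearMap.hasSum
    (NormedSpace.exp_series_hasSum_exp' (𝕂 := ℝ) B)
  exact h.nonneg fun n => mul_nonneg (by positivity) (hpow n i j)

/-- Adding a large multiple of the identity makes all entries nonnegative and only multiplies the
exponential by a positive scalar. -/
theorem Matrix.exp_apply_nonneg_of_offDiag {B : Matrix ι ι ℝ} (hB : ∀ i j, i ≠ j → 0 ≤ B i j)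
    (i j : ι) : 0 ≤ NormedSpace.exp B i j := by
  set c : ℝ := ∑ k, |B k k| with hc
  have h1 : B = (B + c • 1) + Matrix.diagonal (fun _ => -c) := by
    ext k l
    by_cases h : k = l <;> simp [h]
  have hcomm : Commute (B + c • 1) (Matrix.diagonal (fun _ : ι => -c)) := by
    have : Matrix.diagonal (fun _ : ι => -c) = (-c) • (1 : Matrix ι ι ℝ) := by
      rw [Matrix.smul_one_eq_diagonal]
    rw [this]
    exact (Commute.one_right _).smul_right _
  rw [h1, Matrix.exp_add_of_commute _ _ hcomm, Matrix.exp_diagonal, Matrix.mul_diagonal,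
    Pi.coe_exp, ← Real.exp_eq_exp_ℝ]
  refine mul_nonneg (Matrix.exp_apply_nonneg (fun k l => ?_) i j) (Real.exp_pos _).le
  by_cases h : k = l
  · subst h
    have : |B k k| ≤ c := Finset.single_le_sum (f := fun k => |B k k|)
      (fun _ _ => abs_nonneg _) (Finset.mem_univ k)
    simp
    linarith [neg_abs_le (B k k)]
  · simp [h, hB k l h]

end MatrixExp

/-! ### The killed semigroup on a finite set and its comparison with the path law. -/

namespace SpeedGraph

variable {V : Type u} (Γ : SpeedGraph V) [DecidableEq V] (A : Finset V)

/-- The generator of the walk killed when it leaves `A`. -/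
def killedGen : Matrix A A ℝ := fun x y => Γ.jumpRate x y - if x = y then Γ.rate x else 0

/-- The transition probabilities of the walk killed when it leaves `A`. -/
def killedSemigroup (t : ℝ) : Matrix A A ℝ := NormedSpace.exp (t • Γ.killedGen A)

theorem hasDerivAt_killedSemigroup (x y : A) (t : ℝ) :
    HasDerivAt (fun t => Γ.killedSemigroup A t x y)
      (∑ z, Γ.killedSemigroup A t x z * Γ.jumpRate z y
        - Γ.killedSemigroup A t x y * Γ.rate y) t := by
  have h := Matrix.hasDerivAt_exp_smul_apply (Γ.killedGen A) x y t
  refine h.congr_deriv ?_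
  simp [killedGen, mul_sub, Finset.sum_sub_distrib, killedSemigroup]

theorem continuous_killedSemigroup (x y : A) : Continuous fun t => Γ.killedSemigroup A t x y :=
  continuous_iff_continuousAt.2 fun t => (Γ.hasDerivAt_killedSemigroup A x y t).continuousAt

theorem killedSemigroup_zero (x y : A) :
    Γ.killedSemigroup A 0 x y = if x = y then 1 else 0 := by
  rw [killedSemigroup, zero_smul, NormedSpace.exp_zero, Matrix.one_apply]

theorem killedSemigroup_add (s t : ℝ) (x y : A) : Γ.killedSemigroup A (s + t) x y =
    ∑ z, Γ.killedSemigroup A s x z * Γ.killedSemigroup A t z y := by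
  rw [killedSemigroup, add_smul, Matrix.exp_add_of_commute _ _
    (((Commute.refl _).smul_left s).smul_right t), Matrix.mul_apply]
  rfl

theorem killedSemigroup_nonneg {t : ℝ} (ht : 0 ≤ t) (x y : A) :
    0 ≤ Γ.killedSemigroup A t x y := by
  refine Matrix.exp_apply_nonneg_of_offDiag (fun i j hij => ?_) x y
  simp only [Matrix.smul_apply, killedGen, hij, if_false, sub_zero, smul_eq_mul]
  exact mul_nonneg ht (Γ.jumpRate_nonneg _ _)

/-- Detailed balance: since `θ_x * jumpRate x y = π_{xy}` is symmetric, conjugation by the diagonal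
matrix of `θ` transposes the generator, hence its exponential. -/
theorem killedSemigroup_symm (t : ℝ) (x y : A) :
    Γ.θ x * Γ.killedSemigroup A t x y = Γ.θ y * Γ.killedSemigroup A t y x := by
  set D : Matrix A A ℝ := Matrix.diagonal fun x : A => Γ.θ x with hD
  have hunit : IsUnit D := by
    rw [Matrix.isUnit_iff_isUnit_det, hD, Matrix.det_diagonal, isUnit_iff_ne_zero]
    exact Finset.prod_ne_zero_iff.2 fun x _ => (Γ.θ_pos x).ne'
  have hdet : IsUnit D.det := (Matrix.isUnit_iff_isUnit_det D).1 hunit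
  have hDL : D * (t • Γ.killedGen A) = (t • Γ.killedGen A).transpose * D := by
    ext x y
    rw [hD, Matrix.diagonal_mul, Matrix.mul_diagonal]
    simp only [Matrix.smul_apply, Matrix.transpose_apply, killedGen, smul_eq_mul, jumpRate]
    have h1 := (Γ.θ_pos x).ne'
    have h2 := (Γ.θ_pos y).ne'
    rw [Γ.π_symm y x]
    by_cases h : x = y
    · subst h
      ring
    · rw [if_neg h, if_neg (Ne.symm h)]
      field_simp
      ring
  have h1 : D * (t • Γ.killedGen A) * D⁻¹ = (t • Γ.killedGen A).transpose := by
    rw [hDL, Matrix.mul_assoc, Matrix.mul_nonsing_inv _ hdet, Matrix.mul_one]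
  have h2 : D * Γ.killedSemigroup A t * D⁻¹ = (Γ.killedSemigroup A t).transpose := by
    rw [killedSemigroup, ← Matrix.exp_conj _ _ hunit, h1, Matrix.exp_transpose]
  have h3 : D * Γ.killedSemigroup A t = (Γ.killedSemigroup A t).transpose * D := by
    rw [← h2, Matrix.mul_assoc _ _ D, Matrix.nonsing_inv_mul _ hdet, Matrix.mul_one]
  have h4 := congrFun (congrFun h3 x) y
  rw [hD, Matrix.diagonal_mul, Matrix.mul_diagonal, Matrix.transpose_apply] at h4
  rw [h4, mul_comm]

/-- The last-jump integral equation, of which `killedProb` is the Picard iteration started at zero.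
It follows by integrating the `s`-derivative of `P_s(x,y) e^{-rate y (t - s)}`. -/
theorem killedSemigroup_duhamel {t : ℝ} (x y : A) :
    Γ.killedSemigroup A t x y = (if x = y then Real.exp (-(Γ.rate y * t)) else 0) +
      ∫ s in (0 : ℝ)..t, ∑ z, Γ.killedSemigroup A s x z *
        (Γ.jumpRate z y * Real.exp (-(Γ.rate y * (t - s)))) := by
  have hd : ∀ s, HasDerivAt
      (fun s => Γ.killedSemigroup A s x y * Real.exp (-(Γ.rate y * (t - s))))
      (∑ z, Γ.killedSemigroup A s x z *
        (Γ.jumpRate z y * Real.exp (-(Γ.rate y * (t - s))))) s := by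
    intro s
    have he : HasDerivAt (fun s => Real.exp (-(Γ.rate y * (t - s))))
        (Real.exp (-(Γ.rate y * (t - s))) * Γ.rate y) s := by
      refine HasDerivAt.exp ?_
      exact (((hasDerivAt_id s).const_sub t).const_mul (Γ.rate y)).neg.congr_deriv (by ring)
    refine ((Γ.hasDerivAt_killedSemigroup A x y s).mul he).congr_deriv ?_
    simp_rw [← mul_assoc, ← Finset.sum_mul]
    ring
  have hc : Continuous fun s => ∑ z, Γ.killedSemigroup A s x z *
        (Γ.jumpRate z y * Real.exp (-(Γ.rate y * (t - s)))) :=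
    continuous_finsetSum _ fun z _ =>
      (Γ.continuous_killedSemigroup A x z).mul (by fun_prop)
  rw [intervalIntegral.integral_eq_sub_of_hasDerivAt (fun s _ => hd s)
    (hc.intervalIntegrable _ _), killedSemigroup_zero]
  by_cases h : x = y <;> simp [h]

theorem sum_nbrs_eq_sum_attach {f : V → ℝ≥0∞} (hf : ∀ z ∉ A, f z = 0) (y : V) (g : ℝ) :
    ∑ z ∈ Γ.nbrs y, f z * ENNReal.ofReal (Γ.jumpRate z y * g) =
      ∑ z : A, f z * ENNReal.ofReal (Γ.jumpRate z y * g) := by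
  rw [Finset.sum_coe_sort A (fun z => f z * ENNReal.ofReal (Γ.jumpRate z y * g))]
  rw [← Finset.sum_filter_of_ne (s := Γ.nbrs y) (p := fun z => z ∈ A),
    ← Finset.sum_filter_of_ne (s := A) (p := fun z => z ∈ Γ.nbrs y)]
  · congr 1
    ext z
    simp [and_comm]
  · intro z _ hz
    rw [Γ.mem_nbrs]
    by_contra h
    simp [jumpRate, Γ.π_eq_zero fun h' => h h'.symm] at hz
  · intro z _ hz
    by_contra h
    simp [hf z h] at hz

theorem ofReal_killedSemigroup {t : ℝ} (ht : 0 ≤ t) (x y : A) :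
    ENNReal.ofReal (Γ.killedSemigroup A t x y) =
      ENNReal.ofReal (if x = y then Real.exp (-(Γ.rate y * t)) else 0) +
      ∫⁻ s in Icc 0 t, ∑ z : A, ENNReal.ofReal (Γ.killedSemigroup A s x z) *
        ENNReal.ofReal (Γ.jumpRate z y * Real.exp (-(Γ.rate y * (t - s)))) := by
  have hnn : ∀ s ∈ Icc 0 t, ∀ z : A, 0 ≤ Γ.killedSemigroup A s x z *
        (Γ.jumpRate z y * Real.exp (-(Γ.rate y * (t - s)))) := fun s hs z =>
    mul_nonneg (Γ.killedSemigroup_nonneg A hs.1 x z)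
      (mul_nonneg (Γ.jumpRate_nonneg _ _) (Real.exp_pos _).le)
  have hc : Continuous fun s => ∑ z, Γ.killedSemigroup A s x z *
        (Γ.jumpRate z y * Real.exp (-(Γ.rate y * (t - s)))) :=
    continuous_finsetSum _ fun z _ =>
      (Γ.continuous_killedSemigroup A x z).mul (by fun_prop)
  rw [killedSemigroup_duhamel, intervalIntegral.integral_of_le ht,
    ← integral_Icc_eq_integral_Ioc, ENNReal.ofReal_add,
    ofReal_integral_eq_lintegral_ofReal hc.continuousOn.integrableOn_Icc]
  · congr 1
    refine setLIntegral_congr_fun measurableSet_Icc fun s hs => ?_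
    rw [ENNReal.ofReal_sum_of_nonneg fun z _ => hnn s hs z]
    exact Finset.sum_congr rfl fun z _ =>
      ENNReal.ofReal_mul (Γ.killedSemigroup_nonneg A hs.1 x z)
  · exact (ae_restrict_iff' measurableSet_Icc).2 (.of_forall fun s hs =>
      Finset.sum_nonneg fun z _ => hnn s hs z)
  · split_ifs <;> positivity
  · exact setIntegral_nonneg measurableSet_Icc fun s hs =>
      Finset.sum_nonneg fun z _ => hnn s hs z

variable [MeasurableSpace V] [DiscreteMeasurableSpace V] [Nontrivial V] [Countable V]

theorem killedProb_succ_coe (n : ℕ) {t : ℝ} (ht : 0 ≤ t) (x y : A) :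
    Γ.killedProb A x (n + 1) t y =
      ENNReal.ofReal (if x = y then Real.exp (-(Γ.rate y * t)) else 0) +
      ∫⁻ s in Icc 0 t, ∑ z : A, Γ.killedProb A x n s z *
        ENNReal.ofReal (Γ.jumpRate z y * Real.exp (-(Γ.rate y * (t - s)))) := by
  rw [killedProb, if_pos y.2, jumpProb_zero Γ _ ht]
  congr 1
  · simp only [← Subtype.ext_iff, eq_comm]
  · exact lintegral_congr fun s => Γ.sum_nbrs_eq_sum_attach A
      (fun z hz => Γ.killedProb_of_notMem _ _ _ hz) _ _

theorem killedProb_le_killedSemigroup (n : ℕ) {t : ℝ} (ht : 0 ≤ t) (x y : A) :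
    Γ.killedProb A x n t y ≤ ENNReal.ofReal (Γ.killedSemigroup A t x y) := by
  induction n generalizing t y with
  | zero => exact zero_le
  | succ n ih =>
    rw [killedProb_succ_coe Γ A n ht, ofReal_killedSemigroup Γ A ht]
    refine add_le_add le_rfl ?_
    refine setLIntegral_mono' measurableSet_Icc fun s hs => ?_
    gcongr with z
    exact ih hs.1 z

/-- The Picard remainder: each iteration integrates the previous error against a kernel of total
mass at most `K`, which produces `(K t)^n / n!`. As this tends to zero, the semigroup is at most the
limit of the iterates. -/
theorem killedSemigroup_le_killedProb_add (T : ℝ) (x : A) : ∃ C K : ℝ, 0 ≤ C ∧ 0 ≤ K ∧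
    ∀ (n : ℕ) (t : ℝ), 0 ≤ t → t ≤ T → ∀ y : A, ENNReal.ofReal (Γ.killedSemigroup A t x y) ≤
      Γ.killedProb A x n t y + ENNReal.ofReal (C * ((K * t) ^ n / n.factorial)) := by
  have hbdd : ∃ C : ℝ, 0 ≤ C ∧ ∀ t ∈ Icc 0 T, ∀ y : A, Γ.killedSemigroup A t x y ≤ C := by
    have hc : Continuous fun t => ∑ y, |Γ.killedSemigroup A t x y| :=
      continuous_finsetSum _ fun y _ => (Γ.continuous_killedSemigroup A x y).abs
    obtain ⟨C, hC⟩ := (isCompact_Icc (a := (0 : ℝ)) (b := T)).exists_bound_of_continuousOn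
      hc.continuousOn
    refine ⟨|C|, abs_nonneg _, fun t ht y => ?_⟩
    have h1 := Finset.single_le_sum (f := fun y => |Γ.killedSemigroup A t x y|)
      (fun _ _ => abs_nonneg _) (Finset.mem_univ y)
    exact (le_abs_self _).trans (h1.trans ((le_abs_self _).trans
      ((hC t ht).trans (le_abs_self _))))
  obtain ⟨C, hC0, hC⟩ := hbdd
  -- A crude bound, uniform in `y`, for the total rate of jumps into `y` from within `A`.
  set K : ℝ := ∑ y : A, ∑ z : A, Γ.jumpRate z y with hK
  have hK0 : 0 ≤ K := Finset.sum_nonneg fun y _ => Finset.sum_nonneg fun z _ =>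
    Γ.jumpRate_nonneg _ _
  refine ⟨C, K, hC0, hK0, fun n => ?_⟩
  induction n with
  | zero =>
    intro t ht hT y
    simpa [killedProb] using ENNReal.ofReal_le_ofReal (hC t ⟨ht, hT⟩ y)
  | succ n ih =>
    intro t ht hT y
    rw [killedProb_succ_coe Γ A n ht, ofReal_killedSemigroup Γ A ht, add_assoc]
    refine add_le_add le_rfl ?_
    have hKy : ∑ z : A, Γ.jumpRate z y ≤ K :=
      Finset.single_le_sum (f := fun y : A => ∑ z : A, Γ.jumpRate z y)
        (fun _ _ => Finset.sum_nonneg fun z _ => Γ.jumpRate_nonneg _ _) (Finset.mem_univ y)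
    have hstep : ∀ s ∈ Icc 0 t, ∑ z : A, ENNReal.ofReal (Γ.killedSemigroup A s x z) *
        ENNReal.ofReal (Γ.jumpRate z y * Real.exp (-(Γ.rate y * (t - s)))) ≤
        ∑ z : A, Γ.killedProb A x n s z *
          ENNReal.ofReal (Γ.jumpRate z y * Real.exp (-(Γ.rate y * (t - s)))) +
        ENNReal.ofReal (C * ((K * s) ^ n / n.factorial) * K) := by
      intro s hs
      have hks : 0 ≤ C * ((K * s) ^ n / n.factorial) :=
        mul_nonneg hC0 (div_nonneg (pow_nonneg (mul_nonneg hK0 hs.1) _) (by positivity))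
      calc _ ≤ ∑ z : A, (Γ.killedProb A x n s z +
            ENNReal.ofReal (C * ((K * s) ^ n / n.factorial))) *
            ENNReal.ofReal (Γ.jumpRate z y * Real.exp (-(Γ.rate y * (t - s)))) := by
              gcongr with z
              exact ih s hs.1 (hs.2.trans hT) z
        _ ≤ _ := by
          simp_rw [add_mul]
          rw [Finset.sum_add_distrib, ← Finset.mul_sum]
          gcongr
          rw [ENNReal.ofReal_mul hks]
          gcongr
          rw [← ENNReal.ofReal_sum_of_nonneg fun z _ =>
            mul_nonneg (Γ.jumpRate_nonneg _ _) (Real.exp_pos _).le]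
          refine ENNReal.ofReal_le_ofReal (le_trans (Finset.sum_le_sum fun z _ => ?_) hKy)
          refine mul_le_of_le_one_right (Γ.jumpRate_nonneg _ _) (Real.exp_le_one_iff.2 ?_)
          have := mul_nonneg (Γ.rate_pos y).le (sub_nonneg.2 hs.2)
          linarith
    refine (setLIntegral_mono' measurableSet_Icc hstep).trans ?_
    rw [lintegral_add_right _ (by fun_prop)]
    refine add_le_add le_rfl ?_
    have hcp : Continuous fun s : ℝ => C * ((K * s) ^ n / n.factorial) * K := by fun_prop
    rw [← ofReal_integral_eq_lintegral_ofReal hcp.continuousOn.integrableOn_Icc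
      ((ae_restrict_iff' measurableSet_Icc).2 (.of_forall fun s hs => mul_nonneg
        (mul_nonneg hC0 (div_nonneg (pow_nonneg (mul_nonneg hK0 hs.1) _) (by positivity))) hK0)),
      integral_Icc_eq_integral_Ioc, ← intervalIntegral.integral_of_le ht]
    refine ENNReal.ofReal_le_ofReal (le_of_eq ?_)
    have : ∀ s : ℝ, C * ((K * s) ^ n / n.factorial) * K =
        C * K ^ (n + 1) / n.factorial * s ^ n := fun s => by ring
    simp_rw [this]
    rw [intervalIntegral.integral_const_mul, integral_pow, Nat.factorial_succ]
    push_cast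
    have : (n.factorial : ℝ) ≠ 0 := by positivity
    field_simp
    ring

theorem killedSemigroup_le_pathLaw {t : ℝ} (ht : 0 ≤ t) (x y : A) :
    Γ.killedSemigroup A t x y ≤ (Γ.pathLaw x).real {ω | walk t ω = some (y : V)} := by
  obtain ⟨C, K, hC, hK, h⟩ := Γ.killedSemigroup_le_killedProb_add A t x
  rw [Measure.real, ← ENNReal.ofReal_le_iff_le_toReal (measure_ne_top _ _), pathLaw_walk_eq]
  have hlim : Filter.Tendsto (fun n : ℕ => ∑' k, Γ.jumpProb (x : V) k t y +
      ENNReal.ofReal (C * ((K * t) ^ n / n.factorial))) Filter.atTop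
      (nhds (∑' k, Γ.jumpProb (x : V) k t y + ENNReal.ofReal (C * 0))) :=
    tendsto_const_nhds.add (ENNReal.tendsto_ofReal
      ((FloorSemiring.tendsto_pow_div_factorial_atTop (K * t)).const_mul C))
  simp only [mul_zero, ENNReal.ofReal_zero, add_zero] at hlim
  refine ge_of_tendsto' hlim fun n => (h n t ht le_rfl y).trans ?_
  gcongr
  exact (Γ.killedProb_le A _ n t _).trans (ENNReal.sum_le_tsum _)

omit A in
theorem pathLaw_le_of_killedSemigroup_le {t : ℝ} (ht : 0 ≤ t) (x y : V) {B : ℝ} (hB : 0 ≤ B)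
    (h : ∀ (A : Finset V) (hx : x ∈ A) (hy : y ∈ A),
      Γ.killedSemigroup A t ⟨x, hx⟩ ⟨y, hy⟩ ≤ B) :
    (Γ.pathLaw x).real {ω | walk t ω = some y} ≤ B := by
  refine ENNReal.toReal_le_of_le_ofReal hB ?_
  rw [pathLaw_walk_eq, ENNReal.tsum_eq_iSup_nat]
  refine iSup_le fun n => ?_
  obtain ⟨A₀, hA₀⟩ := Γ.exists_killedProb_eq x n y
  have hx : x ∈ insert x (insert y A₀) := by simp
  have hy : y ∈ insert x (insert y A₀) := by simp
  rw [← hA₀ (insert x (insert y A₀))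
    (fun z hz => Finset.mem_insert_of_mem (Finset.mem_insert_of_mem hz)) t]
  exact (Γ.killedProb_le_killedSemigroup _ n ht ⟨x, hx⟩ ⟨y, hy⟩).trans
    (ENNReal.ofReal_le_ofReal (h _ hx hy))

end SpeedGraph

/-! ### Weighted energy estimates for the killed heat kernel. -/

theorem Real.cosh_le_one_add_sq {x : ℝ} (hx : |x| ≤ 1) : Real.cosh x ≤ 1 + x ^ 2 := by
  have h1 : x ^ 2 ≤ 1 := (sq_le_one_iff_abs_le_one x).2 hx
  refine (Real.cosh_le_exp_half_sq x).trans ?_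
  have h2 := Real.add_one_le_exp (-(x ^ 2 / 2))
  have h3 : Real.exp (x ^ 2 / 2) * Real.exp (-(x ^ 2 / 2)) = 1 := by
    rw [← Real.exp_add, add_neg_cancel, Real.exp_zero]
  have h4 := Real.exp_pos (x ^ 2 / 2)
  nlinarith [sq_nonneg x]

/-- Telescoping ratios gives `(A^m, γ^m)`-regularity, so the scale factor can be made as large as
the iteration needs. -/
theorem IsAGammaRegular.pow {A γ : ℝ} {f : ℝ → ℝ} (h : IsAGammaRegular A γ f) (m : ℕ)
    {t₁ t₂ : ℝ} (h1 : 0 < t₁) (h12 : t₁ < t₂) :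
    f (γ ^ m * t₁) / f t₁ ≤ A ^ m * (f (γ ^ m * t₂) / f t₂) := by
  have hγ : 0 < γ := zero_lt_one.trans h.one_lt
  have h2 : 0 < t₂ := h1.trans h12
  induction m with
  | zero => simp [(h.pos t₁ h1).ne', (h.pos t₂ h2).ne']
  | succ m ih =>
    have p1 : 0 < γ ^ m * t₁ := by positivity
    have p2 : 0 < γ ^ m * t₂ := by positivity
    have f1 := h.pos _ p1
    have f2 := h.pos _ p2
    have e1 := h.pos _ h1
    have e2 := h.pos _ h2
    have hs := h.ratio_le _ _ p1 (mul_lt_mul_of_pos_left h12 (pow_pos hγ m))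
    have q2 := h.pos _ (mul_pos hγ p2)
    have hA : 0 ≤ A := zero_le_one.trans h.one_le
    have key := mul_le_mul hs ih (div_nonneg f1.le e1.le) (by positivity)
    calc f (γ ^ (m + 1) * t₁) / f t₁
        = f (γ * (γ ^ m * t₁)) / f (γ ^ m * t₁) * (f (γ ^ m * t₁) / f t₁) := by
          rw [div_mul_div_cancel₀ f1.ne', pow_succ']
          ring_nf
      _ ≤ _ := key
      _ = A ^ (m + 1) * (f (γ ^ (m + 1) * t₂) / f t₂) := by
          rw [pow_succ' γ, mul_assoc γ]
          field_simp
          ring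

namespace SpeedGraph

section Energy

variable {V : Type u} {Γ : SpeedGraph V} {d : V → V → ℝ}

theorem IsAdaptedMetric.self (h : Γ.IsAdaptedMetric d) (x : V) : d x x = 0 :=
  (h.eq_zero_iff x x).2 rfl

theorem IsAdaptedMetric.nonneg (h : Γ.IsAdaptedMetric d) (x y : V) : 0 ≤ d x y := by
  have := h.triangle x y x
  rw [h.self, h.symm y x] at this
  linarith

variable (Γ) in
theorem sum_mul_le_sum_nbrs (A : Finset V) (y : V) {g : V → ℝ} (hg : ∀ z, 0 ≤ g z) :
    ∑ z : A, Γ.π y z * g z ≤ ∑ z ∈ Γ.nbrs y, Γ.π y z * g z := by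
  classical
  rw [Finset.sum_coe_sort A (fun z => Γ.π y z * g z),
    ← Finset.sum_filter_of_ne (s := A) (p := fun z => z ∈ Γ.nbrs y)]
  · refine Finset.sum_le_sum_of_subset_of_nonneg (fun z hz => (Finset.mem_filter.1 hz).2) ?_
    exact fun z _ _ => mul_nonneg (Γ.π_nonneg y z) (hg z)
  · intro z _ hz
    rw [Γ.mem_nbrs]
    by_contra h
    simp [Γ.π_eq_zero h] at hz

/-- With `v = u e^{l d / 2}`, symmetrising the cross terms produces `cosh` of an increment of size
at most `l d(y,z) / 2`, hence a factor at most `1 + l² d(y,z)² / 4`. The `1` is cancelled by the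
killing and jump-out term `π_y`, and adaptedness bounds the rest by `θ_y`. -/
theorem IsAdaptedMetric.energy_inequality (h : Γ.IsAdaptedMetric d) (A : Finset V)
    (x : V) {l : ℝ} (h0 : 0 ≤ l) (h1 : l ≤ 1) (u : A → ℝ) :
    ∑ y : A, 2 * u y * Real.exp (l * d x y) * (∑ z : A, u z * Γ.π z y - u y * Γ.πv y) ≤
      l ^ 2 / 2 * ∑ y : A, u y ^ 2 * Real.exp (l * d x y) * Γ.θ y := by
  set a : V → ℝ := fun y => l * d x y / 2 with ha
  set v : A → ℝ := fun y => u y * Real.exp (a y) with hv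
  have hexp : ∀ y, Real.exp (l * d x y) = Real.exp (a y) * Real.exp (a y) := fun y => by
    rw [← Real.exp_add]
    congr 1
    simp only [ha]
    ring
  have hvsq : ∀ y : A, u y ^ 2 * Real.exp (l * d x y) = v y ^ 2 := fun y => by
    rw [hexp, hv]
    ring
  have hcross : ∀ y z : A, 2 * u y * Real.exp (l * d x y) * (u z * Γ.π z y) =
      2 * v y * v z * Γ.π y z * Real.exp (a y - a z) := fun y z => by
    rw [hexp, Real.exp_sub, Γ.π_symm z y]
    simp only [hv]
    field_simp
  have hcosh : ∀ y z : A, v y * v z * Γ.π y z * (Real.exp (a y - a z) + Real.exp (a z - a y)) ≤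
      (v y ^ 2 + v z ^ 2) * (Γ.π y z * (1 + l ^ 2 / 4 * d y z ^ 2)) := by
    intro y z
    by_cases hyz : Γ.graph.Adj y z
    · have hd := h.le_one_of_adj _ _ hyz
      have hd0 := h.nonneg y z
      have habs : |d x y - d x z| ≤ d y z := by
        rw [abs_le]
        have t1 := h.triangle x y z
        have t2 := h.triangle x z y
        rw [h.symm z y] at t2
        constructor <;> linarith
      have hΔ : |a y - a z| ≤ l / 2 * d y z := by
        have : a y - a z = l / 2 * (d x y - d x z) := by simp only [ha]; ring
        rw [this, abs_mul, abs_of_nonneg (by positivity)]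
        gcongr
      have hc := Real.cosh_le_one_add_sq (x := a y - a z) (hΔ.trans (by nlinarith))
      have hsq : (a y - a z) ^ 2 ≤ l ^ 2 / 4 * d y z ^ 2 := by
        rw [← sq_abs]
        calc |a y - a z| ^ 2 ≤ (l / 2 * d y z) ^ 2 := by gcongr
          _ = _ := by ring
      have he : Real.exp (a y - a z) + Real.exp (a z - a y) = 2 * Real.cosh (a y - a z) := by
        rw [Real.cosh_eq, neg_sub]
        ring
      have hcp := Real.cosh_pos (a y - a z)
      rw [he]
      calc v y * v z * Γ.π y z * (2 * Real.cosh (a y - a z))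
          = 2 * v y * v z * (Γ.π y z * Real.cosh (a y - a z)) := by ring
        _ ≤ (v y ^ 2 + v z ^ 2) * (Γ.π y z * Real.cosh (a y - a z)) := by
          have := Γ.π_nonneg y z
          gcongr
          exact two_mul_le_add_sq _ _
        _ ≤ _ := by
          have := Γ.π_nonneg y z
          gcongr
          linarith
    · simp [Γ.π_eq_zero hyz]
  have hsum : ∑ y : A, ∑ z : A, 2 * v y * v z * Γ.π y z * Real.exp (a y - a z) ≤
      ∑ y : A, 2 * (v y ^ 2 * (Γ.πv y + l ^ 2 / 4 * Γ.θ y)) := by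
    have hsw : ∑ y : A, ∑ z : A, v y * v z * Γ.π y z * Real.exp (a z - a y) =
        ∑ y : A, ∑ z : A, v y * v z * Γ.π y z * Real.exp (a y - a z) := by
      rw [Finset.sum_comm]
      refine Finset.sum_congr rfl fun y _ => Finset.sum_congr rfl fun z _ => ?_
      rw [Γ.π_symm z y]
      ring
    have e1 : ∑ y : A, ∑ z : A, 2 * v y * v z * Γ.π y z * Real.exp (a y - a z) =
        ∑ y : A, ∑ z : A,
          v y * v z * Γ.π y z * (Real.exp (a y - a z) + Real.exp (a z - a y)) := by
      simp_rw [mul_add, Finset.sum_add_distrib]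
      rw [hsw, ← two_mul, Finset.mul_sum]
      refine Finset.sum_congr rfl fun y _ => ?_
      rw [Finset.mul_sum]
      exact Finset.sum_congr rfl fun z _ => by ring
    have e2 : ∑ y : A, ∑ z : A, v z ^ 2 * (Γ.π y z * (1 + l ^ 2 / 4 * d y z ^ 2)) =
        ∑ y : A, ∑ z : A, v y ^ 2 * (Γ.π y z * (1 + l ^ 2 / 4 * d y z ^ 2)) := by
      rw [Finset.sum_comm]
      refine Finset.sum_congr rfl fun y _ => Finset.sum_congr rfl fun z _ => ?_
      rw [Γ.π_symm z y, h.symm z y]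
    rw [e1]
    refine (Finset.sum_le_sum fun y _ => Finset.sum_le_sum fun z _ => hcosh y z).trans ?_
    simp_rw [add_mul, Finset.sum_add_distrib]
    rw [e2, ← two_mul, Finset.mul_sum]
    refine Finset.sum_le_sum fun y _ => ?_
    rw [← Finset.mul_sum]
    gcongr
    refine (Γ.sum_mul_le_sum_nbrs A y (g := fun z => 1 + l ^ 2 / 4 * d y z ^ 2)
      fun z => by positivity).trans ?_
    have e3 : ∑ z ∈ Γ.nbrs y, Γ.π y z * (1 + l ^ 2 / 4 * d y z ^ 2) =
        Γ.πv y + l ^ 2 / 4 * ∑ z ∈ Γ.nbrs y, Γ.π y z * d y z ^ 2 := by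
      rw [WeightedGraph.πv, Finset.mul_sum, ← Finset.sum_add_distrib]
      exact Finset.sum_congr rfl fun z _ => by ring
    rw [e3]
    have he := h.energy_le_one y
    rw [one_div, inv_mul_le_iff₀ (Γ.θ_pos y), mul_one] at he
    gcongr
  calc _ = ∑ y : A, ∑ z : A, 2 * v y * v z * Γ.π y z * Real.exp (a y - a z) -
        ∑ y : A, 2 * (v y ^ 2 * Γ.πv y) := by
        rw [← Finset.sum_sub_distrib]
        refine Finset.sum_congr rfl fun y _ => ?_
        rw [mul_sub, Finset.mul_sum]
        simp_rw [hcross]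
        rw [← hvsq]
        ring
    _ ≤ ∑ y : A, 2 * (v y ^ 2 * (Γ.πv y + l ^ 2 / 4 * Γ.θ y)) -
        ∑ y : A, 2 * (v y ^ 2 * Γ.πv y) := by gcongr
    _ = _ := by
        rw [← Finset.sum_sub_distrib, Finset.mul_sum]
        refine Finset.sum_congr rfl fun y _ => ?_
        rw [hvsq]
        ring

end Energy

variable {V : Type u} (Γ : SpeedGraph V) [DecidableEq V] (A : Finset V)

/-- The weighted square norm `∑_y p_t(x,y)² e^{l d(x,y)} θ_y` of the heat kernel of the walk
killed when it leaves `A`. -/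
def weightedEnergy (d : V → V → ℝ) (l t : ℝ) (x : A) : ℝ :=
  ∑ y : A, (Γ.killedSemigroup A t x y / Γ.θ y) ^ 2 * Real.exp (l * d x y) * Γ.θ y

theorem weightedEnergy_nonneg (d : V → V → ℝ) (l t : ℝ) (x : A) :
    0 ≤ Γ.weightedEnergy A d l t x :=
  Finset.sum_nonneg fun y _ => by have := Γ.θ_pos y; positivity

theorem killedHeat_symm (t : ℝ) (x y : A) :
    Γ.killedSemigroup A t x y / Γ.θ y = Γ.killedSemigroup A t y x / Γ.θ x := by
  have := Γ.killedSemigroup_symm A t x y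
  rw [div_eq_div_iff (Γ.θ_pos y).ne' (Γ.θ_pos x).ne']
  linarith

theorem killedHeat_add (s t : ℝ) (x y : A) : Γ.killedSemigroup A (s + t) x y / Γ.θ y =
    ∑ z : A, Γ.killedSemigroup A s x z / Γ.θ z *
      (Γ.killedSemigroup A t y z / Γ.θ z) * Γ.θ z := by
  rw [killedSemigroup_add, Finset.sum_div]
  refine Finset.sum_congr rfl fun z _ => ?_
  rw [Γ.killedHeat_symm A t y z]
  have := (Γ.θ_pos z).ne'
  field_simp

theorem weightedEnergy_zero_weight (d : V → V → ℝ) (t : ℝ) (x : A) :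
    Γ.weightedEnergy A d 0 t x = Γ.killedSemigroup A (2 * t) x x / Γ.θ x := by
  rw [two_mul, killedHeat_add, weightedEnergy]
  exact Finset.sum_congr rfl fun z _ => by simp [sq]

theorem weightedEnergy_zero_time {d : V → V → ℝ} (h : Γ.IsAdaptedMetric d) (l : ℝ) (x : A) :
    Γ.weightedEnergy A d l 0 x = 1 / Γ.θ x := by
  rw [weightedEnergy, Finset.sum_eq_single x]
  · have := (Γ.θ_pos x).ne'
    rw [killedSemigroup_zero, if_pos rfl, h.self]
    simp
    field_simp
  · intro y _ hy
    rw [killedSemigroup_zero, if_neg (Ne.symm hy)]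
    simp
  · simp

theorem weightedEnergy_sq_le (d : V → V → ℝ) (l t : ℝ) (x : A) :
    Γ.weightedEnergy A d l t x ^ 2 ≤
      Γ.weightedEnergy A d 0 t x * Γ.weightedEnergy A d (2 * l) t x := by
  have hθ := fun y : A => (Γ.θ_pos y).le
  refine Finset.sum_sq_le_sum_mul_sum_of_sq_le_mul _
    (fun y _ => by have := hθ y; positivity) (fun y _ => by have := hθ y; positivity) ?_
  intro y _
  have : Real.exp (2 * l * d x y) = Real.exp (l * d x y) ^ 2 := by
    rw [← Real.exp_nat_mul]
    congr 1
    push_cast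
    ring
  rw [this]
  refine le_of_eq ?_
  simp
  ring

/-- Grönwall's argument: by the forward equation and the energy inequality, `e^{-l² t / 2} E_l(t)`
is nonincreasing. -/
theorem weightedEnergy_le_exp_mul {d : V → V → ℝ} (h : Γ.IsAdaptedMetric d) {l : ℝ} (h0 : 0 ≤ l)
    (h1 : l ≤ 1) {s t : ℝ} (hst : s ≤ t) (x : A) : Γ.weightedEnergy A d l t x ≤
      Real.exp (l ^ 2 / 2 * (t - s)) * Γ.weightedEnergy A d l s x := by
  set c := l ^ 2 / 2 with hc
  have hd : ∀ t, ∃ E', HasDerivAt (fun t => Γ.weightedEnergy A d l t x) E' t ∧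
      E' ≤ c * Γ.weightedEnergy A d l t x := by
    intro t
    refine ⟨_, HasDerivAt.fun_sum fun y _ =>
      ((((Γ.hasDerivAt_killedSemigroup A x y t).div_const (Γ.θ y)).pow 2).mul_const
        (Real.exp (l * d x y))).mul_const (Γ.θ y), ?_⟩
    refine le_trans (le_of_eq ?_) (h.energy_inequality A x h0 h1
      fun y => Γ.killedSemigroup A t x y / Γ.θ y)
    refine Finset.sum_congr rfl fun y _ => ?_
    have e1 : ∀ z : A, Γ.killedSemigroup A t x z / Γ.θ z * Γ.π z y =
        Γ.killedSemigroup A t x z * Γ.jumpRate z y := fun z => by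
      rw [jumpRate]
      ring
    have e2 : Γ.killedSemigroup A t x y / Γ.θ y * Γ.πv y =
        Γ.killedSemigroup A t x y * Γ.rate y := by
      rw [rate]
      ring
    have := (Γ.θ_pos y).ne'
    simp_rw [e1, e2]
    simp only [Nat.add_one_sub_one, pow_one, Nat.cast_ofNat]
    field_simp
  choose E' hE' hE'le using hd
  have hanti : Antitone fun t => Real.exp (-(c * t)) * Γ.weightedEnergy A d l t x := by
    have hder : ∀ t, HasDerivAt (fun t => Real.exp (-(c * t)) * Γ.weightedEnergy A d l t x)
        (Real.exp (-(c * t)) * -c * Γ.weightedEnergy A d l t x +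
          Real.exp (-(c * t)) * E' t) t := by
      intro t
      refine HasDerivAt.mul ?_ (hE' t)
      exact ((hasDerivAt_id t).const_mul c).neg.exp.congr_deriv (by simp)
    refine antitone_of_deriv_nonpos (fun t => (hder t).differentiableAt) fun t => ?_
    rw [(hder t).deriv]
    have := mul_le_mul_of_nonneg_left (hE'le t) (Real.exp_pos (-(c * t))).le
    linarith
  have key := hanti hst
  simp only at key
  calc Γ.weightedEnergy A d l t x
      = Real.exp (c * t) * (Real.exp (-(c * t)) * Γ.weightedEnergy A d l t x) := by
        rw [← mul_assoc, ← Real.exp_add]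
        simp
    _ ≤ Real.exp (c * t) * (Real.exp (-(c * s)) * Γ.weightedEnergy A d l s x) := by gcongr
    _ = _ := by
        rw [← mul_assoc, ← Real.exp_add]
        ring_nf

/-- The weighted energy estimate, by iterating the Cauchy–Schwarz inequality between the weights
`0` and `2 * l` along the times `t`, `t / g`, `t / g ^ 2`, … until `2 ^ k * l` is of order one. -/
theorem weightedEnergy_le {d : V → V → ℝ} (h : Γ.IsAdaptedMetric d) {f : ℝ → ℝ}
    (hpos : ∀ t, 0 < t → 0 < f t) (hmono : MonotoneOn f (Ioi 0)) {B Cθ A' g : ℝ} (hg : 4 ≤ g)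
    (hreg : ∀ t₁ t₂, 0 < t₁ → t₁ < t₂ → f (g * t₁) / f t₁ ≤ B * (f (g * t₂) / f t₂))
    (hB : 0 ≤ B) (hCθ : 0 < Cθ) (hA' : 0 ≤ A') (hθ : ∀ x, Cθ ≤ Γ.θ x)
    (hf : ∀ t, 0 < t → f t ≤ A' * Real.exp (Real.sqrt t))
    (hdiag : ∀ t, 0 < t → ∀ x : A, Γ.killedSemigroup A t x x / Γ.θ x ≤ 1 / f t)
    (x : A) {l : ℝ} (h0 : 0 < l) (h1 : l ≤ 1) {t : ℝ} (ht : 0 < t) :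
    Γ.weightedEnergy A d l t x ≤
      (B + A' * Real.exp 1 / Cθ) * Real.exp (l ^ 2 * t) / f (t / g ^ 2) := by
  set M := B + A' * Real.exp 1 / Cθ with hM
  have hM0 : 0 ≤ M := by positivity
  have hg0 : 0 < g := by linarith
  have hlarge : ∀ l : ℝ, 1 / 2 < l → l ≤ 1 → ∀ t, 0 < t → Γ.weightedEnergy A d l t x ≤
      M * Real.exp (l ^ 2 * t) / f (t / g ^ 2) := by
    intro l hl hl1 t ht
    have hat : 0 < t / g ^ 2 := by positivity
    have e1 := Γ.weightedEnergy_le_exp_mul A h (by linarith) hl1 ht.le x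
    rw [weightedEnergy_zero_time Γ A h, sub_zero] at e1
    refine e1.trans ?_
    rw [mul_one_div, div_le_div_iff₀ (Γ.θ_pos x) (hpos _ hat)]
    -- Uses `√s ≤ 1 + s`, with `1 / g² ≤ 1 / 16` and `l² / 2 ≥ 1 / 8`.
    have e2 : Real.sqrt (t / g ^ 2) ≤ 1 + l ^ 2 / 2 * t := by
      have hs : Real.sqrt (t / g ^ 2) ≤ 1 + t / g ^ 2 := by
        rw [Real.sqrt_le_left (by positivity)]
        nlinarith
      have hg2 : t / g ^ 2 ≤ t / 16 := by
        gcongr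
        nlinarith
      have hll : 1 / 4 ≤ l ^ 2 := by nlinarith
      nlinarith [mul_le_mul_of_nonneg_right hll ht.le]
    have e3 : f (t / g ^ 2) ≤ A' * (Real.exp 1 * Real.exp (l ^ 2 / 2 * t)) := by
      refine (hf _ hat).trans ?_
      rw [← Real.exp_add]
      gcongr
    calc Real.exp (l ^ 2 / 2 * t) * f (t / g ^ 2)
        ≤ Real.exp (l ^ 2 / 2 * t) * (A' * (Real.exp 1 * Real.exp (l ^ 2 / 2 * t))) := by gcongr
      _ = A' * Real.exp 1 / Cθ * Real.exp (l ^ 2 * t) * Cθ := by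
        have : Real.exp (l ^ 2 * t) = Real.exp (l ^ 2 / 2 * t) * Real.exp (l ^ 2 / 2 * t) := by
          rw [← Real.exp_add]
          ring_nf
        rw [this]
        field_simp
      _ ≤ M * Real.exp (l ^ 2 * t) * Γ.θ x := by
        gcongr
        · linarith
        · exact hθ x
  -- The hypothesis on `k` says that `k` doublings carry `l` above `1 / 2`.
  have hind : ∀ k : ℕ, ∀ l : ℝ, 0 < l → l ≤ 1 → 1 < l * 2 ^ (k + 1) → ∀ t, 0 < t →
      Γ.weightedEnergy A d l t x ≤ M * Real.exp (l ^ 2 * t) / f (t / g ^ 2) := by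
    intro k
    induction k with
    | zero => exact fun l _ hl1 hl t ht => hlarge l (by norm_num at hl; linarith) hl1 t ht
    | succ k ih =>
      intro l hl0 hl1 hl t ht
      rcases lt_or_ge (1 / 2) l with hl2 | hl2
      · exact hlarge l hl2 hl1 t ht
      have htg : 0 < t / g := by positivity
      have p1 : 0 < t / g ^ 2 := by positivity
      have p0 : 0 < t / g / g ^ 2 := by positivity
      have p2 : 0 < 2 * (t / g) := by positivity
      have f1 := hpos _ p1
      have f0 := hpos _ p0
      have f2 := hpos _ p2
      have hlt : t / g / g ^ 2 < t / g ^ 2 := by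
        gcongr
        exact div_lt_self ht (by linarith)
      have hr := hreg _ _ p0 hlt
      have g1 : g * (t / g / g ^ 2) = t / g ^ 2 := by field_simp
      have g2 : g * (t / g ^ 2) = t / g := by field_simp
      rw [g1, g2] at hr
      have hm : f (t / g) ≤ f (2 * (t / g)) := hmono htg p2 (by linarith)
      -- Regularity compares the ratios of `f` at `t / g³` and `t / g²`. Since `B ≤ M`, the bound
      -- squared contains one `M` from the induction and one from here, so the constant does not
      -- grow with `k`.
      have hff : f (t / g ^ 2) ^ 2 ≤ M * (f (2 * (t / g)) * f (t / g / g ^ 2)) := by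
        rw [← mul_div_assoc, div_le_div_iff₀ f0 f1] at hr
        calc f (t / g ^ 2) ^ 2 = f (t / g ^ 2) * f (t / g ^ 2) := sq _
          _ ≤ B * f (t / g) * f (t / g / g ^ 2) := hr
          _ ≤ M * f (2 * (t / g)) * f (t / g / g ^ 2) := by
            have : B ≤ M := le_add_of_nonneg_right (by positivity)
            have := (hpos _ htg).le
            gcongr
          _ = _ := by ring
      have e1 := Γ.weightedEnergy_le_exp_mul A h hl0.le hl1
        (div_le_self ht.le (by linarith : 1 ≤ g)) x
      have e2 := Γ.weightedEnergy_sq_le A d l (t / g) x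
      have e3 : Γ.weightedEnergy A d 0 (t / g) x ≤ 1 / f (2 * (t / g)) := by
        rw [weightedEnergy_zero_weight]
        exact hdiag _ p2 x
      have e4 := ih (2 * l) (by linarith) (by linarith)
        (by rw [pow_succ] at hl; linarith) (t / g) htg
      have n0 := Γ.weightedEnergy_nonneg A d l t x
      have n1 := Γ.weightedEnergy_nonneg A d l (t / g) x
      have n2 := Γ.weightedEnergy_nonneg A d (2 * l) (t / g) x
      refine (pow_le_pow_iff_left₀ n0 (by positivity) two_ne_zero).1 ?_
      calc Γ.weightedEnergy A d l t x ^ 2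
          ≤ (Real.exp (l ^ 2 / 2 * (t - t / g)) * Γ.weightedEnergy A d l (t / g) x) ^ 2 := by
            gcongr
        _ = Real.exp (l ^ 2 * (t - t / g)) * Γ.weightedEnergy A d l (t / g) x ^ 2 := by
            rw [mul_pow, ← Real.exp_nat_mul]
            congr 2
            push_cast
            ring
        _ ≤ Real.exp (l ^ 2 * (t - t / g)) * (1 / f (2 * (t / g)) *
            (M * Real.exp ((2 * l) ^ 2 * (t / g)) / f (t / g / g ^ 2))) := by
            gcongr
            exact e2.trans (by gcongr)
        _ = M * Real.exp (l ^ 2 * (t + 3 * (t / g))) /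
            (f (2 * (t / g)) * f (t / g / g ^ 2)) := by
            have : Real.exp (l ^ 2 * (t + 3 * (t / g))) =
                Real.exp (l ^ 2 * (t - t / g)) * Real.exp ((2 * l) ^ 2 * (t / g)) := by
              rw [← Real.exp_add]
              ring_nf
            rw [this]
            field_simp
        _ ≤ M * Real.exp (l ^ 2 * (2 * t)) / (f (2 * (t / g)) * f (t / g / g ^ 2)) := by
            -- The exponent closes because `t + 3 t / g ≤ 2 t`.
            have : t / g ≤ t / 4 := by gcongr
            gcongr
            linarith
        _ ≤ (M * Real.exp (l ^ 2 * t) / f (t / g ^ 2)) ^ 2 := by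
            have : Real.exp (l ^ 2 * (2 * t)) = Real.exp (l ^ 2 * t) ^ 2 := by
              rw [← Real.exp_nat_mul]
              congr 1
              push_cast
              ring
            rw [this, div_pow, mul_pow, div_le_div_iff₀ (by positivity) (by positivity)]
            calc M * Real.exp (l ^ 2 * t) ^ 2 * f (t / g ^ 2) ^ 2
                ≤ M * Real.exp (l ^ 2 * t) ^ 2 *
                  (M * (f (2 * (t / g)) * f (t / g / g ^ 2))) := by gcongr
              _ = _ := by ring
  obtain ⟨k, hk⟩ := pow_unbounded_of_one_lt (1 / l) (one_lt_two (α := ℝ))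
  refine hind k l h0 h1 ?_ t ht
  rw [div_lt_iff₀ h0] at hk
  rw [pow_succ]
  nlinarith [pow_pos (two_pos (α := ℝ)) k]

/-- Chapman–Kolmogorov at the midpoint; the triangle inequality distributes `e^{l d(x,y) / 2}` over
the two factors, and `2ab ≤ a² + b²` separates them. -/
theorem killedHeat_le {d : V → V → ℝ} (h : Γ.IsAdaptedMetric d) {l : ℝ} (hl : 0 ≤ l) {t : ℝ}
    (ht : 0 ≤ t) (x y : A) : Γ.killedSemigroup A (t + t) x y / Γ.θ y ≤
      Real.exp (-(l * d x y / 2)) *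
        ((Γ.weightedEnergy A d l t x + Γ.weightedEnergy A d l t y) / 2) := by
  rw [killedHeat_add, weightedEnergy, weightedEnergy, ← Finset.sum_add_distrib, Finset.sum_div,
    Finset.mul_sum]
  refine Finset.sum_le_sum fun z _ => ?_
  have hθ := Γ.θ_pos z
  set a := Γ.killedSemigroup A t x z / Γ.θ z
  set b := Γ.killedSemigroup A t y z / Γ.θ z
  have ha : 0 ≤ a := div_nonneg (Γ.killedSemigroup_nonneg A ht x z) hθ.le
  have hb : 0 ≤ b := div_nonneg (Γ.killedSemigroup_nonneg A ht y z) hθ.le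
  have htri := h.triangle x z y
  rw [h.symm z y] at htri
  have hexp : ∀ w : V, Real.exp (l * d w z) = Real.exp (l * d w z / 2) ^ 2 := fun w => by
    rw [← Real.exp_nat_mul]
    congr 1
    push_cast
    ring
  have e1 : 1 ≤ Real.exp (-(l * d x y / 2)) *
      (Real.exp (l * d x z / 2) * Real.exp (l * d y z / 2)) := by
    rw [← Real.exp_add, ← Real.exp_add, Real.one_le_exp_iff]
    nlinarith
  calc a * b * Γ.θ z = a * b * Γ.θ z * 1 := (mul_one _).symm
    _ ≤ a * b * Γ.θ z * (Real.exp (-(l * d x y / 2)) *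
      (Real.exp (l * d x z / 2) * Real.exp (l * d y z / 2))) := by gcongr
    _ = Real.exp (-(l * d x y / 2)) * Γ.θ z *
      ((2 * (a * Real.exp (l * d x z / 2)) * (b * Real.exp (l * d y z / 2))) / 2) := by ring
    _ ≤ Real.exp (-(l * d x y / 2)) * Γ.θ z *
      (((a * Real.exp (l * d x z / 2)) ^ 2 + (b * Real.exp (l * d y z / 2)) ^ 2) / 2) := by
      gcongr
      exact two_mul_le_add_sq _ _
    _ = _ := by
      rw [hexp x, hexp y]
      ring

end SpeedGraph

end

/-! ### The Gaussian bound. -/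

theorem corollary1p2 :
    ∀ γ : ℝ, 1 < γ → ∃ C₂ > (0 : ℝ), ∃ α > (0 : ℝ),
      ∀ A : ℝ, 1 ≤ A → ∀ Cθ : ℝ, 0 < Cθ → ∃ C₁ > (0 : ℝ),
        ∀ (V : Type u) [Countable V] [Infinite V] [MeasurableSpace V] [DiscreteMeasurableSpace V]
          (Γ : SpeedGraph V) (d : V → V → ℝ) (f : ℝ → ℝ),
          Γ.IsAdaptedMetric d →
          (∀ x, Cθ ≤ Γ.θ x) →
          IsAGammaRegular A γ f →
          (∀ t, 0 < t → f t / Real.exp (Real.sqrt t) ≤ A) →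
          (∀ t, 0 < t → ∀ x, Γ.heatKernel t x x ≤ 1 / f t) →
          ∀ (x₁ x₂ : V) (t : ℝ), max 1 (d x₁ x₂) ≤ t →
            Γ.heatKernel t x₁ x₂ ≤
              C₁ / f (α * t) * Real.exp (-C₂ * (d x₁ x₂ ^ 2 / t)) := by
  intro γ hγ
  obtain ⟨m, hm⟩ := pow_unbounded_of_one_lt (4 : ℝ) hγ
  set g := γ ^ m with hg
  have hg0 : 0 < g := by linarith
  refine ⟨1 / 8, by norm_num, 1 / (2 * g ^ 2), by positivity, fun A hA Cθ hCθ => ?_⟩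
  have hA0 : 0 < A := by linarith
  have hM1 : 1 ≤ A ^ m + A * Real.exp 1 / Cθ :=
    (one_le_pow₀ hA).trans (le_add_of_nonneg_right (by positivity))
  refine ⟨A ^ m + A * Real.exp 1 / Cθ, by linarith, ?_⟩
  intro V _ _ _ _ Γ d f hd hθ hreg hsup hdiag x y t ht
  classical
  have ht1 : 1 ≤ t := (le_max_left _ _).trans ht
  have hdt : d x y ≤ t := (le_max_right _ _).trans ht
  have ht0 : 0 < t := by linarith
  have hαt : 1 / (2 * g ^ 2) * t = t / 2 / g ^ 2 := by field_simp
  have hαt0 : 0 < t / 2 / g ^ 2 := by positivity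
  have hfα := hreg.pos _ hαt0
  rw [hαt]
  -- At distance zero the choice of `l` below degenerates to `0`; there the diagonal bound,
  -- monotonicity of `f` and a constant at least `1` suffice.
  rcases (hd.nonneg x y).eq_or_lt with h0 | h0
  · have hxy := (hd.eq_zero_iff x y).1 h0.symm
    subst hxy
    refine (hdiag t ht0 x).trans ?_
    rw [hd.self]
    simp only [ne_eq, OfNat.ofNat_ne_zero, not_false_eq_true, zero_pow, zero_div, mul_zero,
      Real.exp_zero, mul_one]
    have hle : t / 2 / g ^ 2 ≤ t :=
      (div_le_self (by positivity) (one_le_pow₀ (by linarith))).trans (by linarith)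
    have hf := hreg.mono hαt0 ht0 hle
    gcongr
  have hdiag' : ∀ (B : Finset V) (s : ℝ), 0 < s → ∀ z : B,
      Γ.killedSemigroup B s z z / Γ.θ z ≤ 1 / f s := by
    intro B s hs z
    refine le_trans ?_ (hdiag s hs z)
    rw [SpeedGraph.heatKernel, one_div_mul_eq_div]
    have := (Γ.θ_pos z).le
    gcongr
    exact Γ.killedSemigroup_le_pathLaw B hs.le z z
  have hf' : ∀ s, 0 < s → f s ≤ A * Real.exp (Real.sqrt s) := fun s hs =>
    (div_le_iff₀ (Real.exp_pos _)).1 (hsup s hs)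
  -- This minimises `-l d / 2 + l² t / 2`, with minimum `-d² / (8 t)`, whence the constant `1 / 8`;
  -- `d ≤ t` ensures `l ≤ 1`.
  set l := d x y / (2 * t) with hl
  have hl0 : 0 < l := by positivity
  have hl1 : l ≤ 1 := by
    rw [hl, div_le_one (by positivity)]
    linarith
  have hbound : ∀ (B : Finset V) (hx : x ∈ B) (hy : y ∈ B),
      Γ.killedSemigroup B t ⟨x, hx⟩ ⟨y, hy⟩ / Γ.θ y ≤
        (A ^ m + A * Real.exp 1 / Cθ) / f (t / 2 / g ^ 2) *
          Real.exp (-(1 / 8) * (d x y ^ 2 / t)) := by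
    intro B hx hy
    have hE : ∀ z : B, Γ.weightedEnergy B d l (t / 2) z ≤
        (A ^ m + A * Real.exp 1 / Cθ) * Real.exp (l ^ 2 * (t / 2)) / f (t / 2 / g ^ 2) :=
      fun z => Γ.weightedEnergy_le B hd hreg.pos hreg.mono hm.le
        (fun t₁ t₂ h1 h12 => hreg.pow m h1 h12) (by positivity) hCθ hA0.le hθ hf' (hdiag' B) z
        hl0 hl1 (by positivity)
    have hk := Γ.killedHeat_le B hd hl0.le (t := t / 2) (by positivity) ⟨x, hx⟩ ⟨y, hy⟩
    rw [add_halves] at hk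
    refine hk.trans ?_
    have hexp : Real.exp (-(1 / 8) * (d x y ^ 2 / t)) =
        Real.exp (-(l * d x y / 2)) * Real.exp (l ^ 2 * (t / 2)) := by
      rw [← Real.exp_add]
      congr 1
      rw [hl]
      field_simp
      ring
    calc Real.exp (-(l * d x y / 2)) * ((Γ.weightedEnergy B d l (t / 2) ⟨x, hx⟩ +
          Γ.weightedEnergy B d l (t / 2) ⟨y, hy⟩) / 2)
        ≤ Real.exp (-(l * d x y / 2)) *
          ((A ^ m + A * Real.exp 1 / Cθ) * Real.exp (l ^ 2 * (t / 2)) / f (t / 2 / g ^ 2)) := by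
          refine mul_le_mul_of_nonneg_left ?_ (Real.exp_pos _).le
          linarith [hE ⟨x, hx⟩, hE ⟨y, hy⟩]
      _ = _ := by
          rw [hexp]
          ring
  have hθy := Γ.θ_pos y
  rw [SpeedGraph.heatKernel, one_div_mul_eq_div, div_le_iff₀ hθy]
  refine Γ.pathLaw_le_of_killedSemigroup_le ht0.le x y (by positivity) fun B hx hy => ?_
  rw [← div_le_iff₀ hθy]
  exact hbound B hx hy
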